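/- Let $k\ge 0$ be an integer and let $\alpha_0,\dots,\alpha_k\ge 0$ be real numbers such that $$\mu:=\alpha_0+\cdots+\alpha_k+\tfrac{k-1}{2}>0$$ (for $k\ge 1$ this excludes only the case $k=1$, $\alpha_0=\alpha_1=0$). Let $\mathbf S^k$ be the unit sphere of $\mathbb R^{k+1}$ with its standard surface measure $dS$, and let $h(x)=|x_0|^{\alpha_0}\cdots|x_k|^{\alpha_k}$. Let $$\mathcal D_j u(x)=\frac{\partial u(x)}{\partial x_j}+\alpha_j\,\frac{u(x)-u(\sigma_j(x))}{x_j},\qquad j=0,\dots,k,$$ where $\sigma_j$ is the reflection at the $j$th coordinate hyperplane and where on $x_j=0$ the quotient is replaced by its limit $2\,\partial u(x)/\partial x_j$. A spherical $h$-harmonic of degree $m\in\{0,1,2,\dots\}$ is a homogeneous real polynomial $Y$ of degree $m$ in $x_0,\dots,x_k$ (possibly zero) with $\Delta_hY:=(\mathcal D_0^2+\cdots+\mathcal D_k^2)Y=0$. Let $$\Phi(x,z)=\frac{\Gamma(\mu)}{4\prod_{j=0}^k\Gamma(\alpha_j+\frac12)}\int_{[-1,1]^{k+1}}\Bigl(\|x\|^2-2\sum_{j=0}^k\tau_jx_jz_j+\|z\|^2\Bigr)^{-\mu}\prod_{j=0}^k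 c_{\alpha_j}(1+\tau_j)(1-\tau_j^2)^{\alpha_j-1}\,d\tau,\qquad c_\nu=\frac1{B(\frac12,\nu)},$$ with $B$ the Beta function, where for every $i$ with $\alpha_i=0$ the factor with index $i$ is deleted from the product, $\tau_i$ is set to $1$, and the integration over $\tau_i$ is omitted. Let $Y$ be a spherical $h$-harmonic of degree $m$ and let $\mathcal Y(x)=\|x\|^{-2\mu-2m}Y(x)$. Then, for every $z\in\mathbb R^{k+1}$ with $\|z\|>1$, the integral defining $\Phi(x,z)$ converges absolutely for all $x\in\mathbf S^k$, and $$\mathcal Y(z)=2(\mu+m)\int_{\mathbf S^k}h^2(x)\,\Phi(x,z)\,Y(x)\,dS(x),$$ where the integral converges absolutely. -/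

import Mathlib

noncomputable section

namespace Dunkl

open MeasureTheory

/-- Euclidean space of dimension `k + 1`, with coordinates indexed by `0, …, k`. -/
abbrev Space (k : ℕ) : Type := EuclideanSpace ℝ (Fin (k + 1))

/-- `μ = α₀ + ⋯ + α_k + (k - 1) / 2`. -/
def mu {k : ℕ} (α : Fin (k + 1) → ℝ) : ℝ :=
  (∑ j, α j) + ((k : ℝ) - 1) / 2

/-- The weight `h(x) = |x₀|^α₀ ⋯ |x_k|^α_k`. -/
def weight {k : ℕ} (α : Fin (k + 1) → ℝ) (x : Space k) : ℝ :=
  ∏ j, |x j| ^ α j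

/-- The reflection `σ_j` at the `j`-th coordinate hyperplane. -/
def reflect {k : ℕ} (j : Fin (k + 1)) (x : Space k) : Space k :=
  WithLp.toLp 2 (Function.update (fun i => x i) j (-(x j)))

/-- The partial derivative `∂u/∂x_j`. -/
def partialDeriv {k : ℕ} (j : Fin (k + 1)) (u : Space k → ℝ) (x : Space k) : ℝ :=
  lineDeriv ℝ u x (EuclideanSpace.single j 1)

/-- The Dunkl operator `D_j u(x) = ∂u/∂x_j (x) + α_j (u(x) - u(σ_j x)) / x_j`. On the hyperplane
`x_j = 0` the quotient stands, as usual, for its limit, which is `2 ∂u/∂x_j (x)` for every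
continuously differentiable `u`. -/
def dunkl {k : ℕ} (α : Fin (k + 1) → ℝ) (j : Fin (k + 1)) (u : Space k → ℝ) (x : Space k) : ℝ :=
  partialDeriv j u x +
    α j * (if x j = 0 then 2 * partialDeriv j u x else (u x - u (reflect j x)) / x j)

/-- The Dunkl Laplacian `Δ_h = D₀² + ⋯ + D_k²`. -/
def dunklLaplacian {k : ℕ} (α : Fin (k + 1) → ℝ) (u : Space k → ℝ) (x : Space k) : ℝ :=
  ∑ j, dunkl α j (dunkl α j u) x

/-- A spherical `h`-harmonic of degree `m`: an `h`-harmonic homogeneous polynomial (function) of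
degree `m`; the zero polynomial is allowed. -/
structure IsSphericalHHarmonic {k : ℕ} (α : Fin (k + 1) → ℝ) (m : ℕ) (Y : Space k → ℝ) : Prop where
  /-- `Y` is a homogeneous polynomial of degree `m`. -/
  exists_poly : ∃ p : MvPolynomial (Fin (k + 1)) ℝ, p.IsHomogeneous m ∧
    ∀ x : Space k, Y x = MvPolynomial.eval (fun i => x i) p
  /-- `Y` is `h`-harmonic. -/
  harmonic : ∀ x : Space k, dunklLaplacian α Y x = 0

/-- The external spherical `h`-harmonic `x ↦ ‖x‖ ^ (-2μ - 2m) Y(x)` that belongs to `Y`. -/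
def external {k : ℕ} (α : Fin (k + 1) → ℝ) (m : ℕ) (Y : Space k → ℝ) (x : Space k) : ℝ :=
  ‖x‖ ^ (-2 * mu α - 2 * (m : ℝ)) * Y x

/-- `Ψ(x, z, τ) = ‖x‖² - 2 (τ₀ x₀ z₀ + ⋯ + τ_k x_k z_k) + ‖z‖²`. -/
def psi {k : ℕ} (x z : Space k) (τ : Fin (k + 1) → ℝ) : ℝ :=
  ‖x‖ ^ 2 - 2 * (∑ j, τ j * x j * z j) + ‖z‖ ^ 2

/-- The constant `c_ν = 1 / B(1/2, ν)`. -/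
def betaConst (ν : ℝ) : ℝ := (ProbabilityTheory.beta (1 / 2) ν)⁻¹

/-- The indices of the variables `τ_i` over which one integrates, namely those with `α_i ≠ 0`. -/
abbrev ActiveIndex {k : ℕ} (α : Fin (k + 1) → ℝ) : Type := {i : Fin (k + 1) // α i ≠ 0}

/-- The full vector `τ`: the coordinates without integration are set to `1`. -/
def extendTau {k : ℕ} (α : Fin (k + 1) → ℝ) (τ : ActiveIndex α → ℝ) (i : Fin (k + 1)) : ℝ :=
  if hi : α i ≠ 0 then τ ⟨i, hi⟩ else 1

/-- The cube `[-1, 1] ^ {i : α_i ≠ 0}`. -/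
def cube {k : ℕ} (α : Fin (k + 1) → ℝ) : Set (ActiveIndex α → ℝ) :=
  Set.univ.pi fun _ => Set.Icc (-1) 1

/-- The integrand `Ψ(x, z, τ) ^ (-μ) ∏_j c_{α_j} (1 + τ_j) (1 - τ_j²) ^ (α_j - 1)`, where the product
is over all `j` with `α_j ≠ 0` and `τ_i = 1` in `Ψ` whenever `α_i = 0`. -/
def phiIntegrand {k : ℕ} (α : Fin (k + 1) → ℝ) (x z : Space k) (τ : ActiveIndex α → ℝ) : ℝ :=
  psi x z (extendTau α τ) ^ (-mu α) *
    ∏ j : ActiveIndex α, betaConst (α j) * (1 + τ j) * (1 - τ j ^ 2) ^ (α j - 1)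

/-- The fundamental solution `Φ` of the Dunkl Laplacian. The integral is over the cube with respect
to Lebesgue measure; if all `α_j` vanish, the cube is a single point of mass one. -/
def phi {k : ℕ} (α : Fin (k + 1) → ℝ) (x z : Space k) : ℝ :=
  Real.Gamma (mu α) / (4 * ∏ j, Real.Gamma (α j + 1 / 2)) *
    ∫ τ in cube α, phiIntegrand α x z τ

/-- The standard surface measure on the unit sphere of `ℝ^(k+1)`. -/
def surfaceMeasure (k : ℕ) : Measure (Metric.sphere (0 : Space k) 1) :=
  (volume : Measure (Space k)).toSphere

end Dunkl

end

/-! Put `r = ‖z‖` and `s = ∑ τ_j x_j z_j`. For `‖x‖ = 1` the kernel is `(1 + r² - 2s) ^ (-μ)`. Since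
`|s| ≤ r` and `r > 1`, it is a uniformly convergent power series in `s`, and both integrations, over
`τ` and over the sphere, may be done term by term.

Let `γ_β` be the product of the Dunkl factorials of the exponents `β_i`. The moments of the density
in one variable `τ` are `b! / γ_b` (`integral_pow_mul_tauDensity`), so averaging `s ^ n` over the
cube gives `n! ∑_{|β| = n} x^β z^β / γ_β` (`innerMoment_eq`). Integrating `h²` times a homogeneous
polynomial over the sphere gives a multiple of its Gaussian moment `L`
(`integral_sphere_weight_sq_mul_eval`), and `L` satisfies integration by parts for the Dunkl
operators. For an `h`-harmonic `Y` it follows that `L(x^β Y)` is `L(1) γ_β` times the coefficient of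
`x^β` in `exp(‖x‖²/2) Y` (`gaussFunctional_monomial_mul`). The factors `γ_β` cancel, and the sum
over `β` is the component of degree `n` of `exp(‖z‖²/2) Y(z)`. Hence only `n = m + 2j` survives,
with a multiple of `r^(2j) Y(z)` (`integral_sphere_innerMoment_mul`).

With `a = μ + m`, what remains is the scalar identity `∑_j a Γ(a+2j) / (Γ(a+j+1) j!) r^(2j)
(1+r²)^(-a-2j) = r^(-2a)`. This is the generalized binomial series (`hasSum_ballotCoeff`), proved
from a telescoping second-order differential equation for its partial sums. -/

noncomputable section

/-! ### The generalized binomial series. -/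

namespace Dunkl

open MeasureTheory Filter Topology

/-- The coefficients `a Γ(a + 2j) / (Γ(a + j + 1) j!)` of the generalized binomial series. -/
def ballotCoeff (a : ℝ) (j : ℕ) : ℝ :=
  a * Real.Gamma (a + 2 * j) / (Real.Gamma (a + j + 1) * j.factorial)

lemma ballotCoeff_pos {a : ℝ} (ha : 0 < a) (j : ℕ) : 0 < ballotCoeff a j := by
  unfold ballotCoeff
  have h1 : 0 < Real.Gamma (a + 2 * j) := Real.Gamma_pos_of_pos (by positivity)
  have h2 : 0 < Real.Gamma (a + j + 1) := Real.Gamma_pos_of_pos (by positivity)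
  positivity

lemma ballotCoeff_zero {a : ℝ} (ha : 0 < a) : ballotCoeff a 0 = 1 := by
  have h1 : 0 < Real.Gamma a := Real.Gamma_pos_of_pos ha
  simp only [ballotCoeff, Nat.cast_zero, mul_zero, add_zero, Nat.factorial_zero, Nat.cast_one,
    mul_one, Real.Gamma_add_one ha.ne']
  field_simp

lemma ballotCoeff_succ {a : ℝ} (ha : 0 < a) (j : ℕ) :
    ballotCoeff a (j + 1) * ((j + 1) * (j + 1 + a)) =
      ballotCoeff a j * ((a + 2 * j) * (a + 2 * j + 1)) := by
  have h2 : 0 < Real.Gamma (a + j + 1) := Real.Gamma_pos_of_pos (by positivity)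
  have e1 : Real.Gamma (a + 2 * (j + 1 : ℕ)) =
      (a + 2 * j + 1) * ((a + 2 * j) * Real.Gamma (a + 2 * j)) := by
    rw [← Real.Gamma_add_one (by positivity), ← Real.Gamma_add_one (by positivity)]
    congr 1; push_cast; ring
  have e2 : Real.Gamma (a + (j + 1 : ℕ) + 1) = (a + j + 1) * Real.Gamma (a + j + 1) := by
    rw [← Real.Gamma_add_one (by positivity)]
    congr 1; push_cast; ring
  have h4 : (0 : ℝ) < a + j + 1 := by positivity
  have h5 : (0 : ℝ) < j.factorial := by positivity
  have h6 : (0 : ℝ) < (j : ℝ) + 1 := by positivity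
  simp only [ballotCoeff]
  rw [e1, e2, Nat.factorial_succ]
  push_cast
  field_simp
  ring

/-- The partial sums of the generalized binomial series in the variable `s`. -/
def ballotSum (a : ℝ) (N : ℕ) (s : ℝ) : ℝ :=
  ∑ j ∈ Finset.range N, ballotCoeff a j * (s ^ j * (1 + s) ^ (-a - 2 * j))

/-- The derivative of `ballotSum`, multiplied by `s ^ (a + 1)`. -/
def ballotFlux (a : ℝ) (N : ℕ) (s : ℝ) : ℝ :=
  ∑ j ∈ Finset.range N,
    ballotCoeff a j * (s ^ (a + j) * (1 + s) ^ (-a - 2 * j - 1) * (j - (a + j) * s))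

/-- The telescoping terms of the derivative of `ballotFlux`. -/
def ballotRemainder (a : ℝ) (N : ℕ) (s : ℝ) : ℝ :=
  ballotCoeff a N * (N * (N + a)) * (s ^ (a + N - 1) * (1 + s) ^ (-a - 2 * N))

lemma hasDerivAt_ballotSum {a s : ℝ} (hs : 0 < s) (N : ℕ) :
    HasDerivAt (ballotSum a N) (ballotFlux a N s / s ^ (a + 1)) s := by
  unfold ballotSum ballotFlux
  rw [Finset.sum_div]
  refine HasDerivAt.fun_sum fun j _ => ?_
  have h1 : HasDerivAt (fun s : ℝ => s ^ j) (j * s ^ (j - 1)) s := hasDerivAt_pow j s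
  have h2 : HasDerivAt (fun s : ℝ => (1 + s) ^ (-a - 2 * j))
      (1 * (-a - 2 * j) * (1 + s) ^ (-a - 2 * j - 1)) s :=
    HasDerivAt.rpow_const ((hasDerivAt_id s).const_add 1) (Or.inl (by simp; positivity))
  refine ((h1.mul h2).const_mul (ballotCoeff a j)).congr_deriv ?_
  have e1 : s ^ (a + j) = s ^ (a + 1) * (s ^ j / s) := by
    rw [← Real.rpow_natCast, ← Real.rpow_sub_one hs.ne', ← Real.rpow_add hs]
    congr 1; ring
  have e2 : (1 + s) ^ (-a - 2 * j) = (1 + s) ^ (-a - 2 * j - 1) * (1 + s) := by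
    rw [← Real.rpow_add_one (by positivity)]; congr 1; ring
  have e3 : (j : ℝ) * s ^ (j - 1) = j * (s ^ j / s) := by
    rcases j with _ | j
    · simp
    · simp only [Nat.add_sub_cancel, pow_succ]; field_simp
  have h0 : 0 < s ^ (a + 1) := by positivity
  rw [e1, e2, e3]
  field_simp
  ring

/-- The derivative of the `j`-th summand is the difference of the remainders at `j` and `j + 1`; the
recurrence `ballotCoeff_succ` is exactly what makes the coefficients match. The remainder at `0`
vanishes, so only the last one is left. -/
lemma hasDerivAt_ballotFlux {a s : ℝ} (ha : 0 < a) (hs : 0 < s) (N : ℕ) :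
    HasDerivAt (ballotFlux a N) (-ballotRemainder a N s) s := by
  have h0 : ballotRemainder a 0 s = 0 := by simp [ballotRemainder]
  have : -ballotRemainder a N s =
      ∑ j ∈ Finset.range N, (ballotRemainder a j s - ballotRemainder a (j + 1) s) := by
    rw [Finset.sum_range_sub', h0, zero_sub]
  rw [this]
  unfold ballotFlux
  refine HasDerivAt.fun_sum fun j _ => ?_
  have h1 : HasDerivAt (fun s : ℝ => s ^ (a + j)) (1 * (a + j) * s ^ (a + j - 1)) s :=
    HasDerivAt.rpow_const (hasDerivAt_id s) (Or.inl hs.ne')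
  have h2 : HasDerivAt (fun s : ℝ => (1 + s) ^ (-a - 2 * j - 1))
      (1 * (-a - 2 * j - 1) * (1 + s) ^ (-a - 2 * j - 1 - 1)) s :=
    HasDerivAt.rpow_const ((hasDerivAt_id s).const_add 1) (Or.inl (by simp; positivity))
  have h3 : HasDerivAt (fun s : ℝ => (j : ℝ) - (a + j) * s) (-(a + j)) s := by
    simpa using ((hasDerivAt_id s).const_mul (a + j)).const_sub (j : ℝ)
  refine (((h1.mul h2).mul h3).const_mul (ballotCoeff a j)).congr_deriv ?_
  have e1 : s ^ (a + j) = s ^ (a + j - 1) * s := by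
    rw [← Real.rpow_add_one hs.ne']; congr 1; ring
  have e2 : (1 + s) ^ (-a - 2 * j - 1) = (1 + s) ^ (-a - 2 * j - 1 - 1) * (1 + s) := by
    rw [← Real.rpow_add_one (by positivity)]; congr 1; ring
  have e3 : (1 + s) ^ (-a - 2 * j) = (1 + s) ^ (-a - 2 * j - 1 - 1) * (1 + s) * (1 + s) := by
    rw [← Real.rpow_add_one (by positivity), ← Real.rpow_add_one (by positivity)]; congr 1; ring
  have e4 : (1 + s) ^ (-a - 2 * (j + 1 : ℕ)) = (1 + s) ^ (-a - 2 * j - 1 - 1) := by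
    congr 1; push_cast; ring
  have e5 : s ^ (a + (j + 1 : ℕ) - 1) = s ^ (a + j - 1) * s := by
    rw [← Real.rpow_add_one hs.ne']; congr 1; push_cast; ring
  have e6 : ballotCoeff a (j + 1) * ((j + 1 : ℕ) * ((j + 1 : ℕ) + a)) =
      ballotCoeff a j * ((a + 2 * j) * (a + 2 * j + 1)) := by
    rw [← ballotCoeff_succ ha]; push_cast; ring
  simp only [ballotRemainder, Pi.mul_apply]
  rw [e3, e4, e5, e6, e2, e1]
  ring

lemma ballotRemainder_le {a s t : ℝ} (ha : 0 < a) (ht : 0 < t) (hts : t ≤ s) (hs : s < 1) (N : ℕ) :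
    ballotRemainder a (N + 1) t ≤
      ballotCoeff a (N + 1) * ((N + 1) * (N + 1 + a)) * (s ^ a * (s / (1 + s) ^ 2) ^ N) := by
  have hs0 : 0 < s := ht.trans_le hts
  have e1 : t ^ (a + (N + 1 : ℕ) - 1) = t ^ a * t ^ N := by
    rw [← Real.rpow_natCast, ← Real.rpow_add ht]; congr 1; push_cast; ring
  have e2 : (1 + t) ^ (-a - 2 * (N + 1 : ℕ)) = (1 + t) ^ (-a - 2) * (((1 + t) ^ 2) ^ N)⁻¹ := by
    rw [← pow_mul, ← Real.rpow_natCast, ← Real.rpow_neg (by positivity),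
      ← Real.rpow_add (by positivity)]
    congr 1; push_cast; ring
  have h1 : (1 + t) ^ (-a - 2) ≤ 1 :=
    Real.rpow_le_one_of_one_le_of_nonpos (by linarith) (by linarith)
  -- The function `t / (1 + t)²` increases on `(0, 1)`, so the right endpoint gives a bound uniform
  -- in `t`.
  have h2 : t / (1 + t) ^ 2 ≤ s / (1 + s) ^ 2 := by
    rw [div_le_div_iff₀ (by positivity) (by positivity)]
    nlinarith [mul_nonneg (sub_nonneg.2 hts) (show 0 ≤ 1 - s * t by nlinarith)]
  have h3 : t ^ a ≤ s ^ a := Real.rpow_le_rpow ht.le hts ha.le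
  unfold ballotRemainder
  rw [e1, e2]
  push_cast
  have hA := ballotCoeff_pos ha (N + 1)
  refine mul_le_mul_of_nonneg_left ?_ (by positivity)
  calc t ^ a * t ^ N * ((1 + t) ^ (-a - 2) * (((1 + t) ^ 2) ^ N)⁻¹)
      = t ^ a * (1 + t) ^ (-a - 2) * (t / (1 + t) ^ 2) ^ N := by rw [div_pow]; ring
    _ ≤ s ^ a * 1 * (s / (1 + s) ^ 2) ^ N := by gcongr
    _ = _ := by ring

/-- The flux vanishes at `0` because `a > 0`, so the mean value theorem bounds it by its derivative.
The factor `s ^ (a + 1)` is kept since it cancels the denominator in `hasDerivAt_ballotSum`. -/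
lemma abs_ballotFlux_le {a s : ℝ} (ha : 0 < a) (hs0 : 0 < s) (hs : s < 1) (N : ℕ) :
    |ballotFlux a (N + 1) s| ≤
      ballotCoeff a (N + 1) * ((N + 1) * (N + 1 + a)) * (s / (1 + s) ^ 2) ^ N * s ^ (a + 1) := by
  have hc : ContinuousOn (ballotFlux a (N + 1)) (Set.Icc 0 s) := by
    unfold ballotFlux
    refine continuousOn_finsetSum _ fun j _ => ContinuousOn.mul continuousOn_const ?_
    refine ((ContinuousOn.rpow_const continuousOn_id fun x _ => Or.inr (by positivity)).mul
      (ContinuousOn.rpow_const (by fun_prop) fun x hx => Or.inl ?_)).mul (by fun_prop)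
    have := hx.1
    simp; positivity
  obtain ⟨c, hc, he⟩ := exists_hasDerivAt_eq_slope _ _ hs0 hc
    fun x hx => hasDerivAt_ballotFlux ha hx.1 (N + 1)
  have h0 : ballotFlux a (N + 1) 0 = 0 := by
    refine Finset.sum_eq_zero fun j _ => ?_
    rw [Real.zero_rpow (by positivity)]; simp
  rw [h0, sub_zero, sub_zero, eq_div_iff hs0.ne'] at he
  have hle := ballotRemainder_le ha hc.1 hc.2.le hs N
  have hnn : 0 ≤ ballotRemainder a (N + 1) c := by
    have := ballotCoeff_pos ha (N + 1)
    have := hc.1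
    unfold ballotRemainder; positivity
  rw [← he, abs_mul, abs_neg, abs_of_nonneg hnn, abs_of_pos hs0]
  calc _ ≤ _ := mul_le_mul_of_nonneg_right hle hs0.le
    _ = _ := by rw [Real.rpow_add_one hs0.ne']; ring

/-- A second use of the mean value theorem. With `N + 1` terms the summand `j = 0` is present, and
it gives the value `1` at `s = 0`. -/
lemma abs_ballotSum_sub_one_le {a s : ℝ} (ha : 0 < a) (hs0 : 0 < s) (hs : s < 1) (N : ℕ) :
    |ballotSum a (N + 1) s - 1| ≤
      ballotCoeff a (N + 1) * ((N + 1) * (N + 1 + a)) * (s / (1 + s) ^ 2) ^ N := by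
  have hc : ContinuousOn (ballotSum a (N + 1)) (Set.Icc 0 s) := by
    unfold ballotSum
    refine continuousOn_finsetSum _ fun j _ => ContinuousOn.mul continuousOn_const ?_
    refine ContinuousOn.mul (by fun_prop)
      (ContinuousOn.rpow_const (by fun_prop) fun x hx => Or.inl ?_)
    have := hx.1
    simp; positivity
  obtain ⟨c, hc, he⟩ := exists_hasDerivAt_eq_slope _ _ hs0 hc
    fun x hx => hasDerivAt_ballotSum (a := a) hx.1 (N + 1)
  have h0 : ballotSum a (N + 1) 0 = 1 := by
    unfold ballotSum
    rw [Finset.sum_eq_single 0]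
    · simp [ballotCoeff_zero ha]
    · intro j _ hj; simp [hj]
    · simp
  rw [h0, sub_zero, eq_div_iff hs0.ne'] at he
  have hc1 := hc.1
  have hA := ballotCoeff_pos ha (N + 1)
  have hle := abs_ballotFlux_le ha hc.1 (hc.2.trans hs) N
  have h2 : c / (1 + c) ^ 2 ≤ s / (1 + s) ^ 2 := by
    rw [div_le_div_iff₀ (by positivity) (by positivity)]
    nlinarith [mul_nonneg (sub_nonneg.2 hc.2.le) (show 0 ≤ 1 - s * c by nlinarith [hc.2])]
  rw [← he, abs_mul, abs_div, abs_of_pos hs0, abs_of_pos (show 0 < c ^ (a + 1) by positivity)]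
  calc _ ≤ |ballotFlux a (N + 1) c| / c ^ (a + 1) := mul_le_of_le_one_right (by positivity) hs.le
    _ ≤ ballotCoeff a (N + 1) * ((N + 1) * (N + 1 + a)) * (c / (1 + c) ^ 2) ^ N := by
      rw [div_le_iff₀ (by positivity)]; exact hle
    _ ≤ _ := by gcongr

/-- The generalized binomial series, in the variable `s` that rationalizes its square root. -/
theorem hasSum_ballotCoeff {a s : ℝ} (ha : 0 < a) (hs0 : 0 < s) (hs : s < 1) :
    HasSum (fun j : ℕ => ballotCoeff a j * (s ^ j * (1 + s) ^ (-a - 2 * j))) 1 := by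
  have hnn : ∀ j : ℕ, 0 ≤ ballotCoeff a j * (s ^ j * (1 + s) ^ (-a - 2 * j)) := fun j => by
    have := ballotCoeff_pos ha j
    positivity
  rw [hasSum_iff_tendsto_nat_of_nonneg hnn, ← tendsto_add_atTop_iff_nat 1,
    tendsto_iff_norm_sub_tendsto_zero]
  set q := s / (1 + s) ^ 2 with hq
  have hq0 : 0 < q := by positivity
  -- The prefactors of `q ^ N` grow with limiting ratio `4`, and `4q < 1` amounts to `(1 - s)² > 0`.
  have hq1 : q * 4 < 1 := by
    rw [hq, div_mul_eq_mul_div, div_lt_one (by positivity)]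
    nlinarith [sq_pos_of_pos (sub_pos.2 hs)]
  have hpos : ∀ N : ℕ, 0 < ballotCoeff a (N + 1) * ((N + 1) * (N + 1 + a)) * q ^ N := fun N => by
    have := ballotCoeff_pos ha (N + 1)
    positivity
  have hsum : Summable fun N : ℕ => ballotCoeff a (N + 1) * ((N + 1) * (N + 1 + a)) * q ^ N := by
    refine summable_of_ratio_test_tendsto_lt_one hq1 (Eventually.of_forall fun N => (hpos N).ne') ?_
    have hr : ∀ N : ℕ, ‖ballotCoeff a (N + 1 + 1) *
          (((N + 1 : ℕ) + 1) * ((N + 1 : ℕ) + 1 + a)) * q ^ (N + 1)‖ /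
        ‖ballotCoeff a (N + 1) * ((N + 1) * (N + 1 + a)) * q ^ N‖ =
          q * ((2 + a * (1 / ((N : ℝ) + 1))) *
            (2 + (1 - a) * (1 / ((N : ℝ) + 1 + a)))) := fun N => by
      have h := hpos (N + 1)
      rw [Real.norm_of_nonneg h.le, Real.norm_of_nonneg (hpos N).le, ballotCoeff_succ ha]
      have := ballotCoeff_pos ha (N + 1)
      push_cast
      field_simp
      ring
    simp_rw [hr]
    have l1 : Tendsto (fun N : ℕ => 1 / ((N : ℝ) + 1)) atTop (𝓝 0) :=
      tendsto_one_div_add_atTop_nhds_zero_nat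
    have l2 : Tendsto (fun N : ℕ => 1 / ((N : ℝ) + 1 + a)) atTop (𝓝 0) := by
      refine squeeze_zero (fun N => by positivity) (fun N => ?_) l1
      exact one_div_le_one_div_of_le (by positivity) (by linarith)
    have := ((l1.const_mul a).const_add 2).mul ((l2.const_mul (1 - a)).const_add 2)
    convert this.const_mul q using 2
    norm_num
  exact squeeze_zero (fun _ => norm_nonneg _) (fun N => abs_ballotSum_sub_one_le ha hs0 hs N)
    hsum.tendsto_atTop_zero

end Dunkl

end

/-! ### Dunkl operators and the Gaussian functional on polynomials. -/

noncomputable section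

namespace Dunkl

open MvPolynomial Finset

/-- The Dunkl analogue `b + α (1 - (-1) ^ b)` of the integer `b`. -/
def dunklInt (α : ℝ) (b : ℕ) : ℝ := b + α * (1 - (-1) ^ b)

/-- The Dunkl factorial `∏_{1 ≤ i ≤ b} (i + α (1 - (-1) ^ i))`. -/
def dunklFactorial (α : ℝ) : ℕ → ℝ
  | 0 => 1
  | b + 1 => dunklInt α (b + 1) * dunklFactorial α b

/-- The moments of the weight `|x| ^ (2α) exp (-x² / 2)`, up to the factor `2 ^ (α + 1/2)`. -/
def gaussMoment (α : ℝ) : ℕ → ℝ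
  | 0 => Real.Gamma (α + 1 / 2)
  | 1 => 0
  | b + 2 => (b + 1 + 2 * α) * gaussMoment α b

@[simp]
lemma dunklInt_zero (α : ℝ) : dunklInt α 0 = 0 := by simp [dunklInt]

lemma dunklInt_add_two (α : ℝ) (b : ℕ) : dunklInt α (b + 2) = dunklInt α b + 2 := by
  simp [dunklInt, pow_add]; ring

lemma dunklInt_of_odd (α : ℝ) {b : ℕ} (hb : Odd b) : dunklInt α b = b + 2 * α := by
  simp [dunklInt, hb.neg_one_pow]; ring

lemma dunklInt_of_even (α : ℝ) {b : ℕ} (hb : Even b) : dunklInt α b = b := by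
  simp [dunklInt, hb.neg_one_pow]

lemma dunklInt_succ_pos {α : ℝ} (hα : 0 ≤ α) (b : ℕ) : 0 < dunklInt α (b + 1) := by
  rcases Nat.even_or_odd (b + 1) with h | h
  · rw [dunklInt_of_even α h]; positivity
  · rw [dunklInt_of_odd α h]; positivity

lemma dunklFactorial_pos {α : ℝ} (hα : 0 ≤ α) (b : ℕ) : 0 < dunklFactorial α b := by
  induction b with
  | zero => simp [dunklFactorial]
  | succ b ih => exact mul_pos (dunklInt_succ_pos hα b) ih

lemma gaussMoment_of_odd (α : ℝ) : ∀ {b : ℕ}, Odd b → gaussMoment α b = 0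
  | 0, h => by simp at h
  | 1, _ => rfl
  | b + 2, h => by
    have hb : Odd b := by simpa [parity_simps] using h
    rw [gaussMoment, gaussMoment_of_odd α hb, mul_zero]

/-- Integration by parts for the one-variable Dunkl operator, applied to `x^b` and `x^d`. If `b + d`
is even, all moments involved are odd. If it is odd, exactly one of `b`, `d` is odd and the two
Dunkl integers add up to `b + d + 2α`. The truncated `b - 1` is harmless because `dunklInt α 0 = 0`.
-/
lemma gaussMoment_add_add_one (α : ℝ) (b d : ℕ) :
    gaussMoment α (b + d + 1) =
      dunklInt α b * gaussMoment α (b - 1 + d) + dunklInt α d * gaussMoment α (b + (d - 1)) := by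
  rcases Nat.even_or_odd (b + d) with h | h
  · rw [gaussMoment_of_odd α h.add_one]
    rcases b with _ | b <;> rcases d with _ | d
    · simp
    · rw [gaussMoment_of_odd α (b := 0 + (d + 1 - 1)) (by simpa [parity_simps] using h)]; simp
    · rw [gaussMoment_of_odd α (b := b + 1 - 1 + 0) (by simpa [parity_simps] using h)]; simp
    · have h' : Odd (b + (d + 1)) := by
        rw [Nat.even_iff] at h
        rw [Nat.odd_iff]
        omega
      rw [gaussMoment_of_odd α (b := b + 1 - 1 + (d + 1)) (by simpa using h'),
        gaussMoment_of_odd α (b := b + 1 + (d + 1 - 1))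
          (by rwa [Nat.add_sub_cancel, add_right_comm])]
      simp
  · have hs : dunklInt α b + dunklInt α d = (b + d : ℕ) + 2 * α := by
      rcases Nat.even_or_odd b with hb | hb
      · have hd : Odd d := by rw [Nat.odd_iff] at *; rw [Nat.even_iff] at hb; omega
        rw [dunklInt_of_even α hb, dunklInt_of_odd α hd]; push_cast; ring
      · have hd : Even d := by rw [Nat.odd_iff] at *; rw [Nat.even_iff]; omega
        rw [dunklInt_of_odd α hb, dunklInt_of_even α hd]; push_cast; ring
    rcases b with _ | b <;> rcases d with _ | d
    · simp at h
    · simp only [dunklInt_zero, zero_add, zero_mul, Nat.add_sub_cancel] at hs ⊢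
      rw [hs, gaussMoment]; push_cast; ring
    · simp only [dunklInt_zero, add_zero, zero_mul, Nat.add_sub_cancel] at hs ⊢
      rw [hs, gaussMoment]; push_cast; ring
    · rw [show b + 1 - 1 + (d + 1) = b + d + 1 by omega,
        show b + 1 + (d + 1 - 1) = b + d + 1 by omega, ← add_mul, hs,
        show b + 1 + (d + 1) + 1 = b + d + 1 + 2 by omega, gaussMoment]
      push_cast; ring

variable {σ : Type*}

/-- The Dunkl operator on polynomials. -/
def polyDunkl (α : σ → ℝ) (j : σ) : MvPolynomial σ ℝ →ₗ[ℝ] MvPolynomial σ ℝ :=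
  (basisMonomials σ ℝ).constr ℝ fun s => monomial (s - Finsupp.single j 1) (dunklInt (α j) (s j))

/-- The Gaussian moment functional on polynomials. -/
def gaussFunctional [Fintype σ] (α : σ → ℝ) : MvPolynomial σ ℝ →ₗ[ℝ] ℝ :=
  (basisMonomials σ ℝ).constr ℝ fun s => ∏ i, gaussMoment (α i) (s i)

lemma monomial_eq_smul_basisMonomials (s : σ →₀ ℕ) (c : ℝ) :
    monomial s c = c • basisMonomials σ ℝ s := by
  simp [coe_basisMonomials, smul_monomial]

lemma polyDunkl_monomial (α : σ → ℝ) (j : σ) (s : σ →₀ ℕ) (c : ℝ) :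
    polyDunkl α j (monomial s c) =
      monomial (s - Finsupp.single j 1) (c * dunklInt (α j) (s j)) := by
  rw [monomial_eq_smul_basisMonomials, polyDunkl, map_smul, Module.Basis.constr_basis,
    smul_monomial, smul_eq_mul]

lemma gaussFunctional_monomial [Fintype σ] (α : σ → ℝ) (s : σ →₀ ℕ) (c : ℝ) :
    gaussFunctional α (monomial s c) = c * ∏ i, gaussMoment (α i) (s i) := by
  rw [monomial_eq_smul_basisMonomials, gaussFunctional, map_smul, Module.Basis.constr_basis,
    smul_eq_mul]

lemma gaussFunctional_one [Fintype σ] (α : σ → ℝ) :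
    gaussFunctional α 1 = ∏ i, Real.Gamma (α i + 1 / 2) := by
  rw [← C_1, ← monomial_zero', gaussFunctional_monomial]
  simp [gaussMoment]

lemma coeff_polyDunkl [DecidableEq σ] (α : σ → ℝ) (j : σ) (β : σ →₀ ℕ) (p : MvPolynomial σ ℝ) :
    coeff β (polyDunkl α j p) =
      dunklInt (α j) (β j + 1) * coeff (β + Finsupp.single j 1) p := by
  induction p using MvPolynomial.induction_on' with
  | add p q hp hq => rw [map_add, coeff_add, coeff_add, hp, hq, mul_add]
  | monomial s c =>
    rw [polyDunkl_monomial, coeff_monomial, coeff_monomial]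
    by_cases h : s = β + Finsupp.single j 1
    · subst h
      simp [mul_comm]
    · rw [if_neg h, mul_zero]
      split_ifs with h2
      · have h0 : s j = 0 := by
          by_contra h0
          apply h
          rw [← h2, tsub_add_cancel_of_le]
          simpa using Nat.one_le_iff_ne_zero.2 h0
        simp [h0]
      · rfl

lemma polyDunkl_comm [DecidableEq σ] (α : σ → ℝ) (i j : σ) (p : MvPolynomial σ ℝ) :
    polyDunkl α i (polyDunkl α j p) = polyDunkl α j (polyDunkl α i p) := by
  rcases eq_or_ne i j with rfl | hij
  · rfl
  ext β
  simp only [coeff_polyDunkl, Finsupp.add_apply, Finsupp.single_eq_of_ne hij,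
    Finsupp.single_eq_of_ne hij.symm, add_zero]
  rw [add_right_comm]
  ring

lemma isHomogeneous_polyDunkl [DecidableEq σ] (α : σ → ℝ) (j : σ) {p : MvPolynomial σ ℝ} {m : ℕ}
    (hp : p.IsHomogeneous m) : (polyDunkl α j p).IsHomogeneous (m - 1) := by
  intro β hβ
  rw [coeff_polyDunkl] at hβ
  have h := hp (right_ne_zero_of_mul hβ)
  rw [map_add, Finsupp.weight_single] at h
  simp at h
  omega

/-- The polynomial `x₀² + ⋯ + x_k²`. -/
def normSqPoly (σ : Type*) [Fintype σ] : MvPolynomial σ ℝ := ∑ i, X i ^ 2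

/-- Dunkl operators do not obey the Leibniz rule in general, but they do when one factor is
invariant under the reflection, as `‖x‖²` is. -/
lemma polyDunkl_normSqPoly_mul [Fintype σ] [DecidableEq σ] (α : σ → ℝ) (j : σ) (p : MvPolynomial σ ℝ) :
    polyDunkl α j (normSqPoly σ * p) =
      (2 : ℝ) • (X j * p) + normSqPoly σ * polyDunkl α j p := by
  have key : ∀ i, polyDunkl α j (X i ^ 2 * p) =
      (if i = j then (2 : ℝ) • (X j * p) else 0) + X i ^ 2 * polyDunkl α j p := by
    intro i
    induction p using MvPolynomial.induction_on' with
    | add p q hp hq =>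
      simp only [mul_add, map_add, hp, hq, smul_add]
      split_ifs <;> abel
    | monomial s c =>
      rw [X_pow_eq_monomial, monomial_mul, polyDunkl_monomial, polyDunkl_monomial, monomial_mul]
      split_ifs with hij
      · subst hij
        rw [X, monomial_mul, smul_monomial]
        have e1 : Finsupp.single i 2 + s - Finsupp.single i 1 = Finsupp.single i 1 + s := by
          ext l
          rcases eq_or_ne l i with rfl | hl
          · simp
          · simp [Finsupp.single_eq_of_ne hl]
        have e2 : monomial (Finsupp.single i 2 + (s - Finsupp.single i 1))
            (1 * (c * dunklInt (α i) (s i))) =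
            monomial (Finsupp.single i 1 + s) (c * dunklInt (α i) (s i)) := by
          by_cases h0 : s i = 0
          · simp [h0]
          · rw [one_mul]
            have : Finsupp.single i 2 + (s - Finsupp.single i 1) = Finsupp.single i 1 + s := by
              ext l
              rcases eq_or_ne l i with rfl | hl
              · simp; omega
              · simp [Finsupp.single_eq_of_ne hl]
            rw [this]
        rw [e1, e2, ← map_add]
        congr 1
        rw [Finsupp.add_apply, Finsupp.single_eq_same, add_comm 2, dunklInt_add_two, smul_eq_mul]
        ring
      · rw [zero_add]
        have e1 : Finsupp.single i 2 + s - Finsupp.single j 1 =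
            Finsupp.single i 2 + (s - Finsupp.single j 1) := by
          ext l
          rcases eq_or_ne l j with rfl | hl
          · simp [Finsupp.single_eq_of_ne (Ne.symm hij)]
          · simp [Finsupp.single_eq_of_ne hl]
        rw [e1, Finsupp.add_apply, Finsupp.single_eq_of_ne (Ne.symm hij), zero_add, mul_assoc]
  rw [normSqPoly, Finset.sum_mul, Finset.sum_mul, map_sum, Finset.sum_congr rfl fun i _ => key i,
    Finset.sum_add_distrib]
  simp

lemma polyDunkl_normSqPoly_pow_mul [Fintype σ] [DecidableEq σ] (α : σ → ℝ) (j : σ) (p : MvPolynomial σ ℝ) (n : ℕ) :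
    polyDunkl α j (normSqPoly σ ^ (n + 1) * p) =
      (2 * (n + 1 : ℝ)) • (X j * (normSqPoly σ ^ n * p)) +
        normSqPoly σ ^ (n + 1) * polyDunkl α j p := by
  induction n with
  | zero => simp [polyDunkl_normSqPoly_mul]
  | succ n ih =>
    rw [pow_succ' _ (n + 1), mul_assoc, polyDunkl_normSqPoly_mul, ih]
    simp only [smul_eq_C_mul, mul_add]
    push_cast
    simp only [map_mul, map_add, map_one]
    ring

/-- The truncation of `exp (‖x‖² / 2) p`. -/
def expMul [Fintype σ] (N : ℕ) (p : MvPolynomial σ ℝ) : MvPolynomial σ ℝ :=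
  ∑ i ∈ range N, (1 / (2 ^ i * i.factorial : ℝ)) • (normSqPoly σ ^ i * p)

/-- The product rule for `exp(‖x‖²/2) p`. Differentiating the exponential lowers the power of `‖x‖²`
by one, hence the shorter truncation in the last term. -/
lemma polyDunkl_expMul [Fintype σ] [DecidableEq σ] (α : σ → ℝ) (j : σ) (p : MvPolynomial σ ℝ) (N : ℕ) :
    polyDunkl α j (expMul (N + 1) p) = expMul (N + 1) (polyDunkl α j p) + X j * expMul N p := by
  simp only [expMul, Finset.sum_range_succ', map_add, map_sum, map_smul,
    polyDunkl_normSqPoly_pow_mul, smul_add, Finset.sum_add_distrib, Finset.mul_sum, smul_smul]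
  have : ∀ n : ℕ, 1 / (2 ^ (n + 1) * ((n + 1).factorial : ℝ)) * (2 * (n + 1)) =
      1 / (2 ^ n * n.factorial) := fun n => by
    rw [Nat.factorial_succ]
    have : (0 : ℝ) < n.factorial := by positivity
    have h1 : (0 : ℝ) < n + 1 := by positivity
    push_cast
    field_simp
    ring
  simp only [this, mul_smul_comm]
  simp only [pow_zero, one_mul]
  abel

lemma prod_add_single [Fintype σ] [DecidableEq σ] (F : σ → ℕ → ℝ) (β : σ →₀ ℕ) (j : σ) (d : ℕ) :
    ∏ i, F i ((β + Finsupp.single j d) i) = F j (β j + d) * ∏ i ∈ univ.erase j, F i (β i) := by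
  rw [← Finset.mul_prod_erase univ _ (mem_univ j)]
  congr 1
  · simp
  · refine Finset.prod_congr rfl fun i hi => ?_
    simp [Finsupp.single_eq_of_ne (ne_of_mem_erase hi)]

/-- The functional `gaussFunctional` turns `x_j` into a skew derivation. -/
lemma gaussFunctional_X_mul_mul [Fintype σ] [DecidableEq σ] (α : σ → ℝ) (j : σ) (p q : MvPolynomial σ ℝ) :
    gaussFunctional α (X j * (p * q)) =
      gaussFunctional α (polyDunkl α j p * q) + gaussFunctional α (p * polyDunkl α j q) := by
  induction p using MvPolynomial.induction_on' with
  | add p₁ p₂ h₁ h₂ => simp only [add_mul, mul_add, map_add, h₁, h₂]; ring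
  | monomial s a =>
    induction q using MvPolynomial.induction_on' with
    | add q₁ q₂ h₁ h₂ => simp only [mul_add, map_add, h₁, h₂]; ring
    | monomial t b =>
      rw [X, polyDunkl_monomial, polyDunkl_monomial, monomial_mul, monomial_mul, monomial_mul,
        monomial_mul, gaussFunctional_monomial, gaussFunctional_monomial,
        gaussFunctional_monomial]
      have e : ∀ u : σ →₀ ℕ, (∀ i, i ≠ j → u i = s i + t i) →
          ∏ i, gaussMoment (α i) (u i) =
            gaussMoment (α j) (u j) * ∏ i ∈ univ.erase j, gaussMoment (α i) (s i + t i) := by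
        intro u hu
        rw [← Finset.mul_prod_erase univ _ (mem_univ j)]
        congr 1
        exact Finset.prod_congr rfl fun i hi => by rw [hu i (ne_of_mem_erase hi)]
      rw [e _ fun i hi => by simp [Finsupp.single_eq_of_ne hi],
        e _ fun i hi => by simp [Finsupp.single_eq_of_ne hi],
        e _ fun i hi => by simp [Finsupp.single_eq_of_ne hi]]
      have h := gaussMoment_add_add_one (α j) (s j) (t j)
      simp only [Finsupp.add_apply, Finsupp.single_eq_same, Finsupp.tsub_apply]
      rw [add_comm 1, h]
      ring

/-- The two arguments differ by `α_j (p - p ∘ σ_j)`, which is odd in `x_j` and so has zero Gaussian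
moment. -/
lemma gaussFunctional_X_mul_polyDunkl [Fintype σ] [DecidableEq σ] (α : σ → ℝ) (j : σ) (p : MvPolynomial σ ℝ) :
    gaussFunctional α (X j * polyDunkl α j p) = gaussFunctional α (X j * pderiv j p) := by
  induction p using MvPolynomial.induction_on' with
  | add p q hp hq => simp only [mul_add, map_add, hp, hq]
  | monomial s c =>
    rw [polyDunkl_monomial, pderiv_monomial, X, monomial_mul, monomial_mul,
      gaussFunctional_monomial, gaussFunctional_monomial]
    rcases Nat.even_or_odd (s j) with h | h
    · rw [dunklInt_of_even _ h]
    · have h0 : ∏ i, gaussMoment (α i)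
          ((Finsupp.single j 1 + (s - Finsupp.single j 1) : σ →₀ ℕ) i) = 0 := by
        refine Finset.prod_eq_zero (mem_univ j) (gaussMoment_of_odd _ ?_)
        have := h.pos
        have e : (Finsupp.single j 1 + (s - Finsupp.single j 1) : σ →₀ ℕ) j = s j := by simp; omega
        rwa [e]
      rw [h0]; simp

/-- By Euler's identity `m L(p) = L(∑ x_j ∂_j p) = L(∑ x_j D_j p)`, and integration by parts against
`1` turns this into `L(Δ_h p) = 0`. -/
lemma gaussFunctional_eq_zero [Fintype σ] [DecidableEq σ] {α : σ → ℝ} {m : ℕ} (hm : m ≠ 0) {p : MvPolynomial σ ℝ}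
    (hp : p.IsHomogeneous m) (hh : ∑ j, polyDunkl α j (polyDunkl α j p) = 0) :
    gaussFunctional α p = 0 := by
  have h1 : ∑ j, gaussFunctional α (X j * polyDunkl α j p) = 0 := by
    have : ∀ j, gaussFunctional α (X j * polyDunkl α j p) =
        gaussFunctional α (polyDunkl α j (polyDunkl α j p)) := fun j => by
      have := gaussFunctional_X_mul_mul α j 1 (polyDunkl α j p)
      have h1 : polyDunkl α j (1 : MvPolynomial σ ℝ) = 0 := by
        rw [← C_1, ← monomial_zero', polyDunkl_monomial]; simp
      simpa [h1] using this
    rw [Finset.sum_congr rfl fun j _ => this j, ← map_sum, hh, map_zero]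
  rw [Finset.sum_congr rfl fun j _ => gaussFunctional_X_mul_polyDunkl α j p, ← map_sum,
    hp.sum_X_mul_pderiv, map_nsmul, nsmul_eq_mul] at h1
  exact (mul_eq_zero.1 h1).resolve_left (by exact_mod_cast hm)

lemma coeff_zero_expMul_succ [Fintype σ] (N : ℕ) (p : MvPolynomial σ ℝ) :
    coeff 0 (expMul (N + 1) p) = coeff 0 p := by
  have h : coeff 0 (normSqPoly σ) = 0 := by
    simp [normSqPoly, coeff_sum, ← constantCoeff_eq]
  rw [expMul, Finset.sum_range_succ', coeff_add, coeff_sum, Finset.sum_eq_zero]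
  · simp
  · intro i _
    simp only [← constantCoeff_eq] at h ⊢
    rw [smul_eq_C_mul]
    simp [h]

/-- Pairing an `h`-harmonic polynomial with a monomial under the Gaussian functional. -/
theorem gaussFunctional_monomial_mul [Fintype σ] [DecidableEq σ] {α : σ → ℝ} {m N : ℕ} {p : MvPolynomial σ ℝ}
    (hp : p.IsHomogeneous m) (hh : ∑ j, polyDunkl α j (polyDunkl α j p) = 0)
    {β : σ →₀ ℕ} (hβ : β.degree < N) :
    gaussFunctional α (monomial β 1 * p) =
      gaussFunctional α 1 * (∏ i, dunklFactorial (α i) (β i)) * coeff β (expMul N p) := by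
  obtain ⟨n, hn⟩ : ∃ n, β.degree = n := ⟨_, rfl⟩
  induction n using Nat.strong_induction_on generalizing β p m N with
  -- Induction on `|β|`: one variable `x_j` is split off and moved by integration by parts, either
  -- onto `p` or onto the remaining monomial. In the first case `p` becomes `D_j p`, of lower degree
  -- but still `h`-harmonic; hence `p` and `m` vary in the induction. The coefficients on the right
  -- satisfy the same recursion by `polyDunkl_expMul`.
  | _ n ih =>
  obtain ⟨N, rfl⟩ : ∃ N', N = N' + 1 := ⟨N - 1, by omega⟩
  by_cases h0 : β = 0
  · subst h0
    rw [coeff_zero_expMul_succ]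
    simp only [monomial_zero', C_1, one_mul, Finsupp.coe_zero, Pi.zero_apply, dunklFactorial,
      Finset.prod_const_one, mul_one]
    rcases eq_or_ne m 0 with rfl | hm
    · rw [totalDegree_eq_zero_iff_eq_C.1 ((totalDegree_zero_iff_isHomogeneous (σ := σ)).2 hp)]
      rw [← mul_one (C _), ← smul_eq_C_mul, map_smul]
      simp [mul_comm]
    · rw [gaussFunctional_eq_zero hm hp hh, hp.coeff_eq_zero (by simpa using hm.symm), mul_zero]
  · obtain ⟨j, hj⟩ : ∃ j, β j ≠ 0 := by
      by_contra! h
      exact h0 (Finsupp.ext h)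
    obtain ⟨β, rfl⟩ : ∃ β', β = β' + Finsupp.single j 1 :=
      ⟨β - Finsupp.single j 1, by
        rw [tsub_add_cancel_of_le]; simpa using Nat.one_le_iff_ne_zero.2 hj⟩
    have hdeg : β.degree + 1 = n := by simpa [map_add] using hn
    have hD : ∑ i, polyDunkl α i (polyDunkl α i (polyDunkl α j p)) = 0 := by
      simp_rw [polyDunkl_comm α _ j p, polyDunkl_comm α _ j, ← map_sum, hh, map_zero]
    have h1 := ih β.degree (by omega) (isHomogeneous_polyDunkl α j hp) hD
      (β := β) (N := N + 1) (by omega) rfl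
    have e : monomial (β + Finsupp.single j 1) (1 : ℝ) = X j * monomial β 1 := by
      rw [X, monomial_mul, add_comm, mul_one]
    rw [e, mul_assoc, gaussFunctional_X_mul_mul, h1, polyDunkl_monomial,
      prod_add_single fun i => dunklFactorial (α i)]
    have hc := congr_arg (coeff β) (polyDunkl_expMul α j p N)
    rw [coeff_polyDunkl, coeff_add] at hc
    have hp' : ∏ i, dunklFactorial (α i) (β i) =
        dunklFactorial (α j) (β j) * ∏ i ∈ univ.erase j, dunklFactorial (α i) (β i) :=
      (Finset.mul_prod_erase univ _ (mem_univ j)).symm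
    -- The term where `D_j` falls on the monomial. Both sides vanish if `β_j = 0`; otherwise the
    -- induction hypothesis applies with the truncation `N`.
    have key : gaussFunctional α (monomial (β - Finsupp.single j 1)
          (1 * dunklInt (α j) (β j)) * p) =
        gaussFunctional α 1 * (∏ i, dunklFactorial (α i) (β i)) * coeff β (X j * expMul N p) := by
      by_cases hj0 : β j = 0
      · rw [coeff_X_mul', if_neg (by simpa using hj0)]
        simp [hj0]
      · obtain ⟨γ, rfl⟩ : ∃ β', β = β' + Finsupp.single j 1 :=
          ⟨β - Finsupp.single j 1, by
            rw [tsub_add_cancel_of_le]; simpa using Nat.one_le_iff_ne_zero.2 hj0⟩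
        have hγ : γ.degree + 1 = (γ + Finsupp.single j 1).degree := by simp [map_add]
        have h2 := ih γ.degree (by omega) hp hh (β := γ) (N := N) (by omega) rfl
        rw [add_tsub_cancel_right, add_comm γ, coeff_X_mul, add_comm _ γ, one_mul,
          prod_add_single fun i => dunklFactorial (α i)]
        have e2 : monomial γ (dunklInt (α j) ((γ + Finsupp.single j 1 : σ →₀ ℕ) j)) * p =
            dunklInt (α j) (γ j + 1) • (monomial γ 1 * p) := by
          rw [← smul_mul_assoc, smul_monomial]; simp
        rw [e2, map_smul, h2, ← Finset.mul_prod_erase univ _ (mem_univ j)]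
        simp only [dunklFactorial, smul_eq_mul]
        ring
    rw [key, hp']
    simp only [dunklFactorial]
    linear_combination (-(gaussFunctional α 1) *
      (dunklFactorial (α j) (β j) * ∏ i ∈ univ.erase j, dunklFactorial (α i) (β i))) * hc

end Dunkl

end

/-! ### From the analytic to the polynomial Dunkl operators. -/

noncomputable section

namespace Dunkl

open MvPolynomial

lemma hasLineDerivAt_eval {k : ℕ} (p : MvPolynomial (Fin (k + 1)) ℝ) (j : Fin (k + 1))
    (x : Space k) :
    HasLineDerivAt ℝ (fun y : Space k => eval (fun i => y i) p)
      (eval (fun i => x i) (pderiv j p)) x (EuclideanSpace.single j 1) := by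
  unfold HasLineDerivAt
  induction p using MvPolynomial.induction_on with
  | C a => simpa using hasDerivAt_const (0 : ℝ) a
  | add p q hp hq => simp only [map_add]; exact hp.add hq
  | mul_X p i hp =>
    have hi : HasDerivAt (fun t : ℝ => (x + t • EuclideanSpace.single j (1 : ℝ)) i)
        (Pi.single (M := fun _ => ℝ) i 1 j) 0 := by
      rcases eq_or_ne i j with rfl | hij
      · simpa using (hasDerivAt_id (0 : ℝ)).const_add (x i)
      · simpa [hij, hij.symm] using hasDerivAt_const (0 : ℝ) (x i)
    have := hp.mul hi
    simp only [map_mul, eval_X, pderiv_mul, pderiv_X, map_add]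
    refine this.congr_deriv ?_
    rcases eq_or_ne i j with rfl | hij
    · simp
    · simp [hij, hij.symm]

lemma dunkl_eval {k : ℕ} (α : Fin (k + 1) → ℝ) (j : Fin (k + 1))
    (p : MvPolynomial (Fin (k + 1)) ℝ) :
    dunkl α j (fun y : Space k => eval (fun i => y i) p) =
      fun x : Space k => eval (fun i => x i) (polyDunkl α j p) := by
  ext x
  simp only [dunkl, partialDeriv, (hasLineDerivAt_eval p j x).lineDeriv]
  induction p using MvPolynomial.induction_on' with
  | add p q hp hq =>
    simp only [map_add, ← hp, ← hq]
    split_ifs <;> ring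
  | monomial s c =>
    have hprod : ∀ (f : Fin (k + 1) → ℝ) (t : Fin (k + 1) →₀ ℕ),
        t.prod (fun i e => f i ^ e) = f j ^ t j * ∏ i ∈ Finset.univ.erase j, f i ^ t i := by
      intro f t
      rw [Finsupp.prod_fintype _ _ (fun _ => pow_zero _),
        ← Finset.mul_prod_erase _ _ (Finset.mem_univ j)]
    have hE : ∀ (f : Fin (k + 1) → ℝ) (t : Fin (k + 1) →₀ ℕ), (∀ i ≠ j, f i = x i) →
        (∀ i ≠ j, t i = s i) → ∏ i ∈ Finset.univ.erase j, f i ^ t i =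
          ∏ i ∈ Finset.univ.erase j, x i ^ s i := fun f t hf ht =>
      Finset.prod_congr rfl fun i hi => by
        rw [hf i (Finset.ne_of_mem_erase hi), ht i (Finset.ne_of_mem_erase hi)]
    have hs : ∀ i ≠ j, (s - Finsupp.single j 1 : Fin (k + 1) →₀ ℕ) i = s i := fun i hi => by
      simp [Finsupp.single_eq_of_ne hi]
    rw [pderiv_monomial, polyDunkl_monomial]
    simp only [eval_monomial, hprod]
    rw [hE _ _ (fun _ _ => rfl) hs, hE (fun i => reflect j x i) s
      (fun i hi => by simp [reflect, hi]) (fun _ _ => rfl)]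
    have hr : reflect j x j = -x j := by simp [reflect]
    rw [hr]
    simp only [Finsupp.tsub_apply, Finsupp.single_eq_same]
    generalize ∏ i ∈ Finset.univ.erase j, x i ^ s i = P
    obtain h0 | ⟨b, hb⟩ : s j = 0 ∨ ∃ b, s j = b + 1 := by
      rcases s j with _ | b
      · exact Or.inl rfl
      · exact Or.inr ⟨b, rfl⟩
    · simp [h0]
    · rw [hb, Nat.add_sub_cancel]
      split_ifs with hx
      · rw [hx]
        rcases b with _ | b
        · simp [dunklInt]; ring
        · simp
      · simp only [dunklInt, neg_pow (x j)]
        field_simp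
        ring

lemma dunklLaplacian_eval {k : ℕ} (α : Fin (k + 1) → ℝ) (p : MvPolynomial (Fin (k + 1)) ℝ)
    (x : Space k) :
    dunklLaplacian α (fun y : Space k => eval (fun i => y i) p) x =
      eval (fun i => x i) (∑ j, polyDunkl α j (polyDunkl α j p)) := by
  simp only [dunklLaplacian, dunkl_eval, map_sum]

/-- A spherical `h`-harmonic comes from a homogeneous polynomial killed by the polynomial Dunkl
Laplacian. -/
lemma IsSphericalHHarmonic.exists_polyDunkl {k : ℕ} {α : Fin (k + 1) → ℝ} {m : ℕ}
    {Y : Space k → ℝ} (hY : IsSphericalHHarmonic α m Y) :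
    ∃ p : MvPolynomial (Fin (k + 1)) ℝ, p.IsHomogeneous m ∧
      ∑ j, polyDunkl α j (polyDunkl α j p) = 0 ∧
      Y = fun x : Space k => eval (fun i => x i) p := by
  obtain ⟨p, hp, hYp⟩ := hY.exists_poly
  obtain rfl : Y = fun x : Space k => eval (fun i => x i) p := funext hYp
  refine ⟨p, hp, MvPolynomial.funext fun x => ?_, rfl⟩
  have := hY.harmonic (WithLp.toLp 2 x)
  rw [dunklLaplacian_eval] at this
  simpa using this

end Dunkl

end

/-! ### Beta integrals and the moments of the `τ`-density. -/

noncomputable section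

namespace Dunkl

open MeasureTheory Set

lemma ofReal_betaIntegrand (α : ℝ) {x : ℝ} (hx : x ∈ Ioc (0 : ℝ) 1) :
    (x : ℂ) ^ ((α : ℂ) - 1) * (1 - (x : ℂ)) ^ ((α : ℂ) - 1) =
      ((x ^ (α - 1) * (1 - x) ^ (α - 1) : ℝ) : ℂ) := by
  rw [Complex.ofReal_mul, Complex.ofReal_cpow hx.1.le, Complex.ofReal_cpow (by linarith [hx.2])]
  push_cast
  rfl

lemma intervalIntegrable_betaIntegrand {α : ℝ} (hα : 0 < α) :
    IntervalIntegrable (fun x : ℝ => x ^ (α - 1) * (1 - x) ^ (α - 1)) volume 0 1 := by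
  have h := Complex.betaIntegral_convergent (u := α) (v := α) (by simpa) (by simpa)
  rw [intervalIntegrable_iff, uIoc_of_le zero_le_one] at h ⊢
  refine IntegrableOn.congr_fun (f := fun x : ℝ => RCLike.re
    ((x : ℂ) ^ ((α : ℂ) - 1) * (1 - (x : ℂ)) ^ ((α : ℂ) - 1))) h.re (fun x hx => ?_)
    measurableSet_Ioc
  simp only [ofReal_betaIntegrand α hx]
  simp

lemma integral_betaIntegrand {α : ℝ} (hα : 0 < α) :
    ∫ x in (0 : ℝ)..1, x ^ (α - 1) * (1 - x) ^ (α - 1) = ProbabilityTheory.beta α α := by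
  rw [ProbabilityTheory.beta_eq_betaIntegralReal α α hα hα, Complex.betaIntegral]
  have : ∫ x in (0 : ℝ)..1, (x : ℂ) ^ ((α : ℂ) - 1) * (1 - (x : ℂ)) ^ ((α : ℂ) - 1) =
      ∫ x in (0 : ℝ)..1, ((x ^ (α - 1) * (1 - x) ^ (α - 1) : ℝ) : ℂ) := by
    refine intervalIntegral.integral_congr_ae (Filter.Eventually.of_forall fun x hx => ?_)
    rw [uIoc_of_le zero_le_one] at hx
    exact ofReal_betaIntegrand α hx
  rw [this, intervalIntegral.integral_ofReal, Complex.ofReal_re]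

lemma one_sub_sq_rpow_comp (α : ℝ) {x : ℝ} (hx : x ∈ Icc (0 : ℝ) 1) :
    (1 - (2 * x - 1) ^ 2) ^ (α - 1) = 4 ^ (α - 1) * (x ^ (α - 1) * (1 - x) ^ (α - 1)) := by
  have h1 : 0 ≤ 1 - x := by linarith [hx.2]
  rw [← Real.mul_rpow hx.1 h1, ← Real.mul_rpow (by norm_num) (mul_nonneg hx.1 h1)]
  congr 1; ring

lemma intervalIntegrable_one_sub_sq_rpow {α : ℝ} (hα : 0 < α) :
    IntervalIntegrable (fun τ : ℝ => (1 - τ ^ 2) ^ (α - 1)) volume (-1) 1 := by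
  have h := (intervalIntegrable_betaIntegrand hα).const_mul (4 ^ (α - 1))
  have h2 : IntervalIntegrable (fun x : ℝ => (1 - (2 * x - 1) ^ 2) ^ (α - 1)) volume 0 1 := by
    refine h.congr fun x hx => ?_
    rw [uIoc_of_le zero_le_one] at hx
    exact (one_sub_sq_rpow_comp α ⟨hx.1.le, hx.2⟩).symm
  have h3 := (h2.comp_mul_left (c := 1 / 2)).comp_add_right 1
  norm_num at h3
  refine h3.congr fun x _ => ?_
  congr 3; ring

/-- The substitution `τ = 2x - 1` gives a multiple of `B(α, α)`, which the duplication formula for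
`Γ` converts to `B(1/2, α)`. -/
lemma integral_one_sub_sq_rpow {α : ℝ} (hα : 0 < α) :
    ∫ τ in (-1 : ℝ)..1, (1 - τ ^ 2) ^ (α - 1) = ProbabilityTheory.beta (1 / 2) α := by
  have h := intervalIntegral.integral_comp_mul_sub (a := 0) (b := 1) (c := 2)
    (fun τ : ℝ => (1 - τ ^ 2) ^ (α - 1)) two_ne_zero 1
  have h2 : ∫ x in (0 : ℝ)..1, (1 - (2 * x - 1) ^ 2) ^ (α - 1) =
      4 ^ (α - 1) * ProbabilityTheory.beta α α := by
    rw [← integral_betaIntegrand hα, ← intervalIntegral.integral_const_mul]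
    refine intervalIntegral.integral_congr fun x hx => ?_
    rw [uIcc_of_le zero_le_one] at hx
    exact one_sub_sq_rpow_comp α hx
  rw [h2] at h
  norm_num at h
  have h3 := Real.Gamma_mul_Gamma_add_half α
  have g1 : 0 < Real.Gamma (α + 1 / 2) := Real.Gamma_pos_of_pos (by positivity)
  have g2 : 0 < Real.Gamma (2 * α) := Real.Gamma_pos_of_pos (by positivity)
  have e1 : (4 : ℝ) ^ (α - 1) * 2 ^ (1 - 2 * α) * 2 = 1 := by
    rw [show (4 : ℝ) = 2 ^ (2 : ℝ) by norm_num, ← Real.rpow_mul (by norm_num),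
      ← Real.rpow_add (by norm_num), ← Real.rpow_add_one (by norm_num)]
    rw [show 2 * (α - 1) + (1 - 2 * α) + 1 = 0 by ring, Real.rpow_zero]
  have h4 : ∫ τ in (-1 : ℝ)..1, (1 - τ ^ 2) ^ (α - 1) =
      2 * (4 ^ (α - 1) * ProbabilityTheory.beta α α) := by rw [h]; ring
  rw [h4, ProbabilityTheory.beta, ProbabilityTheory.beta, Real.Gamma_one_half_eq, ← two_mul,
    add_comm (1 / 2) α, mul_div_assoc', mul_div_assoc', div_eq_div_iff g2.ne' g1.ne']
  calc 2 * (4 ^ (α - 1) * (Real.Gamma α * Real.Gamma α)) * Real.Gamma (α + 1 / 2)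
      = 2 * 4 ^ (α - 1) * Real.Gamma α * (Real.Gamma α * Real.Gamma (α + 1 / 2)) := by ring
    _ = (4 ^ (α - 1) * 2 ^ (1 - 2 * α) * 2) * (√Real.pi * Real.Gamma α * Real.Gamma (2 * α)) := by
      rw [h3]; ring
    _ = _ := by rw [e1, one_mul]

/-- The moments of the weight `(1 - τ²) ^ (α - 1)` on `[-1, 1]`. -/
def betaMoment (α : ℝ) (b : ℕ) : ℝ := ∫ τ in (-1 : ℝ)..1, τ ^ b * (1 - τ ^ 2) ^ (α - 1)

lemma intervalIntegrable_mul_one_sub_sq_rpow {α : ℝ} (hα : 0 < α) {f : ℝ → ℝ}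
    (hf : Continuous f) :
    IntervalIntegrable (fun τ : ℝ => f τ * (1 - τ ^ 2) ^ (α - 1)) volume (-1) 1 :=
  (intervalIntegrable_one_sub_sq_rpow hα).continuousOn_mul hf.continuousOn

lemma hasDerivAt_one_sub_sq_rpow (α : ℝ) {τ : ℝ} (hτ : τ ∈ Ioo (-1 : ℝ) 1) :
    HasDerivAt (fun τ : ℝ => (1 - τ ^ 2) ^ α) (-2 * α * (τ * (1 - τ ^ 2) ^ (α - 1))) τ := by
  have h0 : 0 < 1 - τ ^ 2 := by nlinarith [hτ.1, hτ.2]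
  have h1 : HasDerivAt (fun τ : ℝ => 1 - τ ^ 2) (-(2 * τ)) τ := by
    simpa using (hasDerivAt_pow 2 τ).const_sub 1
  refine (h1.rpow_const (p := α) (Or.inl h0.ne')).congr_deriv ?_
  ring

lemma betaMoment_zero {α : ℝ} (hα : 0 < α) :
    betaMoment α 0 = ProbabilityTheory.beta (1 / 2) α := by
  simp only [betaMoment, pow_zero, one_mul, integral_one_sub_sq_rpow hα]

lemma continuous_one_sub_sq_rpow {α : ℝ} (hα : 0 < α) :
    Continuous fun τ : ℝ => (1 - τ ^ 2) ^ α :=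
  Continuous.rpow_const (by fun_prop) fun _ => Or.inr hα.le

lemma betaMoment_one {α : ℝ} (hα : 0 < α) : betaMoment α 1 = 0 := by
  have h := intervalIntegral.integral_eq_sub_of_hasDerivAt_of_le (show (-1 : ℝ) ≤ 1 by norm_num)
    (continuous_one_sub_sq_rpow hα).continuousOn (fun x hx => hasDerivAt_one_sub_sq_rpow α hx)
    ((intervalIntegrable_mul_one_sub_sq_rpow hα continuous_id).const_mul _)
  rw [intervalIntegral.integral_const_mul] at h
  simp only [betaMoment, pow_one]
  norm_num [hα.ne'] at h
  exact h

/-- The derivative of `τ^(b+1) (1 - τ²)^α` has integral zero. For `α < 1` that derivative may be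
singular at `±1`, so the fundamental theorem is used with continuity on the closed interval and
differentiability only inside. -/
lemma betaMoment_add_two {α : ℝ} (hα : 0 < α) (b : ℕ) :
    (b + 1 + 2 * α) * betaMoment α (b + 2) = (b + 1) * betaMoment α b := by
  have hi : ∀ n : ℕ, IntervalIntegrable (fun τ : ℝ => τ ^ n * (1 - τ ^ 2) ^ (α - 1))
      volume (-1) 1 := fun n => intervalIntegrable_mul_one_sub_sq_rpow hα (continuous_pow n)
  have h := intervalIntegral.integral_eq_sub_of_hasDerivAt_of_le (show (-1 : ℝ) ≤ 1 by norm_num)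
    (f := fun τ : ℝ => τ ^ (b + 1) * (1 - τ ^ 2) ^ α)
    (f' := fun τ : ℝ => (b + 1) * (τ ^ b * (1 - τ ^ 2) ^ (α - 1)) -
      (b + 1 + 2 * α) * (τ ^ (b + 2) * (1 - τ ^ 2) ^ (α - 1)))
    ((continuous_pow _).mul (continuous_one_sub_sq_rpow hα)).continuousOn
    (fun x hx => ?_) (((hi b).const_mul _).sub ((hi (b + 2)).const_mul _))
  · rw [intervalIntegral.integral_sub ((hi b).const_mul _) ((hi (b + 2)).const_mul _),
      intervalIntegral.integral_const_mul, intervalIntegral.integral_const_mul] at h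
    norm_num [Real.zero_rpow hα.ne'] at h
    unfold betaMoment
    linarith
  · have h0 : 0 < 1 - x ^ 2 := by nlinarith [hx.1, hx.2]
    refine ((hasDerivAt_pow (b + 1) x).mul (hasDerivAt_one_sub_sq_rpow α hx)).congr_deriv ?_
    have e : (1 - x ^ 2) ^ α = (1 - x ^ 2) ^ (α - 1) * (1 - x ^ 2) := by
      rw [← Real.rpow_add_one h0.ne']; congr 1; ring
    rw [e]
    push_cast
    ring

lemma betaMoment_even {α : ℝ} (hα : 0 < α) (i : ℕ) :
    betaMoment α (2 * i) * dunklFactorial α (2 * i) =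
        ProbabilityTheory.beta (1 / 2) α * (2 * i).factorial ∧
      betaMoment α (2 * i + 1) = 0 := by
  induction i with
  | zero => simp [betaMoment_zero hα, betaMoment_one hα, dunklFactorial]
  | succ i ih =>
    refine ⟨?_, ?_⟩
    · have h := betaMoment_add_two hα (2 * i)
      rw [show 2 * (i + 1) = 2 * i + 2 by ring, dunklFactorial, dunklFactorial,
        dunklInt_of_odd α ⟨i, rfl⟩, dunklInt_of_even α (b := 2 * i + 1 + 1) ⟨i + 1, by ring⟩,
        Nat.factorial_succ, Nat.factorial_succ]
      push_cast at h ⊢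
      linear_combination (2 * i + 1 + 1 : ℝ) * dunklFactorial α (2 * i) * h +
        (2 * i + 1 + 1 : ℝ) * (2 * i + 1) * ih.1
    · have h := betaMoment_add_two hα (2 * i + 1)
      rw [ih.2, mul_zero] at h
      have : ((2 * i + 1 : ℕ) : ℝ) + 1 + 2 * α ≠ 0 := by positivity
      exact (mul_eq_zero.1 h).resolve_left this

/-- The factor `1 + τ` of the density pairs each moment with the next one. Exactly one of the two is
nonzero, the one of even order, which makes the formula uniform in the parity of `b`. -/
lemma betaMoment_add_betaMoment_succ {α : ℝ} (hα : 0 < α) (b : ℕ) :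
    betaMoment α b + betaMoment α (b + 1) =
      ProbabilityTheory.beta (1 / 2) α * (b.factorial / dunklFactorial α b) := by
  have hb : 0 < dunklFactorial α b := dunklFactorial_pos hα.le b
  rw [mul_div_assoc', eq_div_iff hb.ne']
  obtain ⟨i, rfl | rfl⟩ := Nat.even_or_odd' b
  · rw [(betaMoment_even hα i).2, add_zero, (betaMoment_even hα i).1]
  · have h := (betaMoment_even hα (i + 1)).1
    rw [show 2 * (i + 1) = 2 * i + 1 + 1 by ring, dunklFactorial,
      dunklInt_of_even α (b := 2 * i + 1 + 1) ⟨i + 1, by ring⟩, Nat.factorial_succ] at h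
    rw [(betaMoment_even hα i).2, zero_add]
    have h0 : ((2 * i + 1 + 1 : ℕ) : ℝ) ≠ 0 := by positivity
    apply mul_left_cancel₀ h0
    push_cast at h ⊢
    linear_combination h

/-- The density of the variable `τ` in the kernel `Φ`. -/
def tauDensity (α τ : ℝ) : ℝ := betaConst α * (1 + τ) * (1 - τ ^ 2) ^ (α - 1)

lemma integrableOn_mul_tauDensity {α : ℝ} (hα : 0 < α) {f : ℝ → ℝ} (hf : Continuous f) :
    IntegrableOn (fun τ => f τ * tauDensity α τ) (Icc (-1) 1) := by
  rw [integrableOn_Icc_iff_integrableOn_Ioc, ← intervalIntegrable_iff_integrableOn_Ioc_of_le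
    (by norm_num)]
  refine (intervalIntegrable_mul_one_sub_sq_rpow hα
    (f := fun τ => f τ * (betaConst α * (1 + τ))) (by fun_prop)).congr fun τ _ => ?_
  simp only [tauDensity]; ring

lemma tauDensity_nonneg {α : ℝ} (hα : 0 < α) {τ : ℝ} (hτ : τ ∈ Icc (-1 : ℝ) 1) :
    0 ≤ tauDensity α τ := by
  have h1 : 0 ≤ 1 - τ ^ 2 := by nlinarith [hτ.1, hτ.2]
  have h2 : 0 ≤ 1 + τ := by linarith [hτ.1]
  have h3 : 0 < betaConst α := inv_pos.2 (ProbabilityTheory.beta_pos (by norm_num) hα)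
  unfold tauDensity
  positivity

lemma integral_pow_mul_tauDensity {α : ℝ} (hα : 0 < α) (b : ℕ) :
    ∫ τ in Icc (-1 : ℝ) 1, τ ^ b * tauDensity α τ = b.factorial / dunklFactorial α b := by
  have hi : ∀ n : ℕ, IntervalIntegrable (fun τ : ℝ => τ ^ n * (1 - τ ^ 2) ^ (α - 1))
      volume (-1) 1 := fun n => intervalIntegrable_mul_one_sub_sq_rpow hα (continuous_pow n)
  have hB : 0 < ProbabilityTheory.beta (1 / 2) α := ProbabilityTheory.beta_pos (by norm_num) hα
  rw [integral_Icc_eq_integral_Ioc, ← intervalIntegral.integral_of_le (by norm_num)]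
  calc ∫ τ in (-1 : ℝ)..1, τ ^ b * tauDensity α τ
      = ∫ τ in (-1 : ℝ)..1, betaConst α * (τ ^ b * (1 - τ ^ 2) ^ (α - 1) +
          τ ^ (b + 1) * (1 - τ ^ 2) ^ (α - 1)) := by
        congr 1; ext τ; simp only [tauDensity]; ring
    _ = betaConst α * (betaMoment α b + betaMoment α (b + 1)) := by
        rw [intervalIntegral.integral_const_mul, intervalIntegral.integral_add (hi _) (hi _)]
        rfl
    _ = _ := by
        rw [betaMoment_add_betaMoment_succ hα, betaConst, inv_mul_cancel_left₀ hB.ne']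

end Dunkl

end

/-! ### Gaussian integrals, polar coordinates and integrals over the sphere. -/

noncomputable section

namespace Dunkl

open MeasureTheory Set MvPolynomial

lemma gaussMoment_even {α : ℝ} (hα : 0 ≤ α) (i : ℕ) :
    gaussMoment α (2 * i) = 2 ^ i * Real.Gamma (α + i + 1 / 2) := by
  induction i with
  | zero => simp [gaussMoment]
  | succ i ih =>
    have e : Real.Gamma (α + (i + 1 : ℕ) + 1 / 2) =
        (α + i + 1 / 2) * Real.Gamma (α + i + 1 / 2) := by
      rw [← Real.Gamma_add_one (by positivity)]; congr 1; push_cast; ring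
    rw [show 2 * (i + 1) = 2 * i + 2 by ring, gaussMoment, ih, e]
    push_cast; ring

lemma integral_Ioi_rpow_mul_exp_neg_half_sq {q : ℝ} (hq : -1 < q) :
    ∫ r in Ioi (0 : ℝ), r ^ q * Real.exp (-r ^ 2 / 2) =
      2 ^ ((q - 1) / 2) * Real.Gamma ((q + 1) / 2) := by
  have h := integral_rpow_mul_exp_neg_mul_rpow (p := 2) (b := 1 / 2) two_pos hq (by norm_num)
  have e : (1 / 2 : ℝ) ^ (-(q + 1) / 2) * (1 / 2) = 2 ^ ((q - 1) / 2) := by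
    rw [one_div, Real.inv_rpow two_pos.le, ← Real.rpow_neg two_pos.le, ← Real.rpow_neg_one 2,
      ← Real.rpow_add two_pos]
    congr 1; ring
  rw [← e, ← h]
  refine setIntegral_congr_fun measurableSet_Ioi fun r _ => ?_
  simp only [Real.rpow_two]
  congr 2; ring

lemma integral_abs_rpow_sq_mul_pow_mul_exp {α : ℝ} (hα : 0 ≤ α) (b : ℕ) :
    ∫ x : ℝ, (|x| ^ α) ^ 2 * x ^ b * Real.exp (-x ^ 2 / 2) =
      2 ^ (α + 1 / 2) * gaussMoment α b := by
  rcases Nat.even_or_odd b with hb | hb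
  · have h1 : ∀ x : ℝ, (|x| ^ α) ^ 2 * x ^ b * Real.exp (-x ^ 2 / 2) =
        (fun r : ℝ => (r ^ α) ^ 2 * r ^ b * Real.exp (-r ^ 2 / 2)) |x| := fun x => by
      simp only [hb.pow_abs, sq_abs]
    simp_rw [h1]
    rw [integral_comp_abs (f := fun r : ℝ => (r ^ α) ^ 2 * r ^ b * Real.exp (-r ^ 2 / 2))]
    obtain ⟨i, rfl⟩ := hb.two_dvd
    have h2 : ∫ r in Ioi (0 : ℝ), (r ^ α) ^ 2 * r ^ (2 * i) * Real.exp (-r ^ 2 / 2) =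
        ∫ r in Ioi (0 : ℝ), r ^ (2 * α + 2 * i) * Real.exp (-r ^ 2 / 2) := by
      refine setIntegral_congr_fun measurableSet_Ioi fun r hr => ?_
      have hr : 0 < r := hr
      rw [Real.rpow_add hr, ← Real.rpow_natCast, ← Real.rpow_natCast, ← Real.rpow_mul hr.le]
      push_cast
      rw [mul_comm α 2]
    have hq : -1 < 2 * α + 2 * (i : ℝ) := by
      have : 0 ≤ 2 * α + 2 * (i : ℝ) := by positivity
      linarith
    rw [h2, integral_Ioi_rpow_mul_exp_neg_half_sq hq, gaussMoment_even hα,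
      show (2 * α + 2 * (i : ℝ) + 1) / 2 = α + i + 1 / 2 by ring, ← mul_assoc, ← mul_assoc]
    congr 1
    rw [← Real.rpow_natCast, ← Real.rpow_add two_pos]
    nth_rw 1 [← Real.rpow_one 2]
    rw [← Real.rpow_add two_pos]
    congr 1; ring
  · rw [gaussMoment_of_odd α hb, mul_zero]
    have h := integral_neg_eq_self (fun x : ℝ => (|x| ^ α) ^ 2 * x ^ b * Real.exp (-x ^ 2 / 2))
      volume
    simp only [abs_neg, hb.neg_pow, even_two.neg_pow, mul_neg, neg_mul, integral_neg] at h
    linarith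

lemma integral_weight_sq_mul_prod_pow_mul_exp {k : ℕ} {α : Fin (k + 1) → ℝ} (hα : ∀ j, 0 ≤ α j)
    (δ : Fin (k + 1) → ℕ) :
    ∫ x : Space k, weight α x ^ 2 * (∏ j, x j ^ δ j) * Real.exp (-‖x‖ ^ 2 / 2) =
      2 ^ (mu α + 1) * ∏ j, gaussMoment (α j) (δ j) := by
  have h1 : ∀ x : Space k, weight α x ^ 2 * (∏ j, x j ^ δ j) * Real.exp (-‖x‖ ^ 2 / 2) =
      (fun y : Fin (k + 1) → ℝ => ∏ j, ((|y j| ^ α j) ^ 2 * y j ^ δ j * Real.exp (-y j ^ 2 / 2)))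
        ((MeasurableEquiv.toLp 2 (Fin (k + 1) → ℝ)).symm x) := fun x => by
    simp only [Finset.prod_mul_distrib, ← Real.exp_sum, EuclideanSpace.real_norm_sq_eq, weight,
      Finset.prod_pow, ← Finset.sum_div, Finset.sum_neg_distrib]
    rfl
  simp_rw [h1]
  rw [(EuclideanSpace.volume_preserving_symm_measurableEquiv_toLp (Fin (k + 1))).integral_comp'
    (fun y : Fin (k + 1) → ℝ => ∏ j, ((|y j| ^ α j) ^ 2 * y j ^ δ j * Real.exp (-y j ^ 2 / 2))),
    integral_fintype_prod_volume_eq_prod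
    (fun j (t : ℝ) => (|t| ^ α j) ^ 2 * t ^ δ j * Real.exp (-t ^ 2 / 2))]
  simp_rw [integral_abs_rpow_sq_mul_pow_mul_exp (hα _)]
  rw [Finset.prod_mul_distrib, ← Real.rpow_sum_of_pos two_pos]
  congr 2
  simp [mu, Finset.sum_add_distrib]
  ring

lemma weight_smul {k : ℕ} (α : Fin (k + 1) → ℝ) {r : ℝ} (hr : 0 < r) (x : Space k) :
    weight α (r • x) = r ^ (∑ j, α j) * weight α x := by
  simp only [weight, PiLp.smul_apply, smul_eq_mul, abs_mul, abs_of_pos hr]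
  simp_rw [Real.mul_rpow hr.le (abs_nonneg _)]
  rw [Finset.prod_mul_distrib, Real.rpow_sum_of_pos hr]

/-- Integration in polar coordinates of a function that is a product along rays. -/
lemma integral_eq_integral_sphere_mul_integral_Ioi {k : ℕ} {f g : Space k → ℝ} {φ : ℝ → ℝ}
    (h : ∀ (x : Metric.sphere (0 : Space k) 1) (r : ℝ), 0 < r → f (r • (x : Space k)) = g x * φ r) :
    ∫ x, f x = (∫ x : Metric.sphere (0 : Space k) 1, g x ∂surfaceMeasure k) *
      ∫ r in Ioi (0 : ℝ), r ^ k * φ r := by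
  have hd : Module.finrank ℝ (Space k) - 1 = k := by simp
  calc ∫ x, f x = ∫ x : ({(0)}ᶜ : Set (Space k)), f x ∂(volume.comap Subtype.val) := by
        rw [integral_subtype_comap (measurableSet_singleton _).compl f, restrict_compl_singleton]
    _ = ∫ x, g x.1 * φ x.2 ∂((volume : Measure (Space k)).toSphere.prod (.volumeIoiPow k)) := by
        have := (volume : Measure (Space k)).measurePreserving_homeomorphUnitSphereProd.integral_comp
          (Homeomorph.measurableEmbedding _) (fun y => g y.1 * φ y.2)
        rw [hd] at this
        rw [← this]
        refine integral_congr_ae (Filter.Eventually.of_forall fun x => ?_)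
        have hx : (0 : ℝ) < ‖(x : Space k)‖ := norm_pos_iff.2 x.2
        have h2 := h (homeomorphUnitSphereProd _ x).1 ‖(x : Space k)‖ hx
        dsimp only
        rw [homeomorphUnitSphereProd_apply_snd_coe, ← h2, homeomorphUnitSphereProd_apply_fst_coe,
          smul_inv_smul₀ hx.ne']
    _ = (∫ x : Metric.sphere (0 : Space k) 1, g x ∂surfaceMeasure k) *
          ∫ r : Ioi (0 : ℝ), φ r ∂.volumeIoiPow k :=
        integral_prod_mul (fun x : Metric.sphere (0 : Space k) 1 => g x)
          (fun r : Ioi (0 : ℝ) => φ r)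
    _ = _ := by
        congr 1
        simp only [Measure.volumeIoiPow, ENNReal.ofReal]
        rw [integral_withDensity_eq_integral_smul,
          integral_subtype_comap measurableSet_Ioi fun a ↦ Real.toNNReal (a ^ k) • φ a,
          setIntegral_congr_fun measurableSet_Ioi fun x hx ↦ ?_]
        · rw [NNReal.smul_def, Real.coe_toNNReal _ (pow_nonneg hx.out.le _), smul_eq_mul]
        · exact (measurable_subtype_coe.pow_const _).real_toNNReal

/-- The integral over the whole space against `exp(-‖x‖²/2)` is known in Cartesian coordinates; in
polar coordinates it is the sphere integral times a radial Gamma integral. -/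
lemma integral_sphere_weight_sq_mul_prod_pow {k : ℕ} {α : Fin (k + 1) → ℝ} (hα : ∀ j, 0 ≤ α j)
    (hμ : 0 < mu α) (δ : Fin (k + 1) → ℕ) {d : ℕ} (hd : ∑ j, δ j = d) :
    ∫ x : Metric.sphere (0 : Space k) 1, weight α x ^ 2 * (∏ j, (x : Space k) j ^ δ j)
        ∂surfaceMeasure k =
      2 / (2 ^ ((d : ℝ) / 2) * Real.Gamma (mu α + 1 + d / 2)) *
        ∏ j, gaussMoment (α j) (δ j) := by
  have h := integral_eq_integral_sphere_mul_integral_Ioi (k := k)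
    (f := fun x => weight α x ^ 2 * (∏ j, x j ^ δ j) * Real.exp (-‖x‖ ^ 2 / 2))
    (g := fun x => weight α x ^ 2 * (∏ j, x j ^ δ j))
    (φ := fun r => r ^ (2 * ∑ j, α j) * r ^ d * Real.exp (-r ^ 2 / 2)) (fun x r hr => by
      have hx : ‖(x : Space k)‖ = 1 := by simp
      simp only [weight_smul α hr, norm_smul, hx, mul_one, Real.norm_of_nonneg hr.le,
        PiLp.smul_apply, smul_eq_mul, mul_pow, Finset.prod_mul_distrib, Finset.prod_pow_eq_pow_sum,
        hd]
      rw [← Real.rpow_natCast (r ^ _) 2, ← Real.rpow_mul hr.le]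
      push_cast
      rw [mul_comm _ (2 : ℝ)]
      ring)
  have h2 : ∫ r in Ioi (0 : ℝ), r ^ k * (r ^ (2 * ∑ j, α j) * r ^ d * Real.exp (-r ^ 2 / 2)) =
      ∫ r in Ioi (0 : ℝ), r ^ (2 * mu α + 1 + d) * Real.exp (-r ^ 2 / 2) := by
    refine setIntegral_congr_fun measurableSet_Ioi fun r hr => ?_
    have hr : 0 < r := hr
    -- The Jacobian contributes `k`, the squared weight `2 ∑ α_j`, and the monomial `d`.
    rw [show 2 * mu α + 1 + d = k + 2 * ∑ j, α j + d by simp only [mu]; ring,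
      Real.rpow_add hr, Real.rpow_add hr, Real.rpow_natCast, Real.rpow_natCast]
    ring
  have hd0 : (0 : ℝ) ≤ d := d.cast_nonneg
  rw [integral_weight_sq_mul_prod_pow_mul_exp hα, h2,
    integral_Ioi_rpow_mul_exp_neg_half_sq (by linarith)] at h
  have hG : 0 < Real.Gamma (mu α + 1 + d / 2) := Real.Gamma_pos_of_pos (by positivity)
  rw [show (2 * mu α + 1 + d + 1) / 2 = mu α + 1 + d / 2 by ring,
    show (2 * mu α + 1 + d - 1) / 2 = mu α + d / 2 by ring, Real.rpow_add two_pos,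
    Real.rpow_add two_pos, Real.rpow_one] at h
  have h3 : (0 : ℝ) < 2 ^ mu α := by positivity
  have h4 : (0 : ℝ) < 2 ^ ((d : ℝ) / 2) := by positivity
  rw [div_mul_eq_mul_div, eq_div_iff (by positivity)]
  apply mul_left_cancel₀ h3.ne'
  linear_combination -h

lemma continuous_weight {k : ℕ} {α : Fin (k + 1) → ℝ} (hα : ∀ j, 0 ≤ α j) :
    Continuous (weight α) := by
  unfold weight
  refine continuous_finsetProd _ fun j _ => Continuous.rpow_const (by fun_prop) fun _ => Or.inr (hα j)

lemma integrable_surfaceMeasure {k : ℕ} {f : Metric.sphere (0 : Space k) 1 → ℝ}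
    (hf : Continuous f) : Integrable f (surfaceMeasure k) := by
  unfold surfaceMeasure
  exact hf.integrable_of_hasCompactSupport (HasCompactSupport.of_compactSpace f)

lemma continuous_eval_space {k : ℕ} (p : MvPolynomial (Fin (k + 1)) ℝ) :
    Continuous fun x : Space k => eval (fun i => x i) p :=
  (MvPolynomial.continuous_eval p).comp (by fun_prop)

/-- Integrals of homogeneous polynomials over the sphere are Gaussian moments. -/
lemma integral_sphere_weight_sq_mul_eval {k : ℕ} {α : Fin (k + 1) → ℝ} (hα : ∀ j, 0 ≤ α j)
    (hμ : 0 < mu α) {d : ℕ} {p : MvPolynomial (Fin (k + 1)) ℝ} (hp : p.IsHomogeneous d) :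
    ∫ x : Metric.sphere (0 : Space k) 1, weight α x ^ 2 * eval (fun i => (x : Space k) i) p
        ∂surfaceMeasure k =
      2 / (2 ^ ((d : ℝ) / 2) * Real.Gamma (mu α + 1 + d / 2)) * gaussFunctional α p := by
  have hw := continuous_weight hα
  have h1 : ∀ x : Metric.sphere (0 : Space k) 1,
      weight α x ^ 2 * eval (fun i => (x : Space k) i) p =
        ∑ δ ∈ p.support, coeff δ p * (weight α x ^ 2 * ∏ j, (x : Space k) j ^ δ j) := fun x => by
    rw [eval_eq', Finset.mul_sum]
    exact Finset.sum_congr rfl fun _ _ => by ring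
  simp_rw [h1]
  rw [integral_finsetSum _ fun δ _ => (integrable_surfaceMeasure (by fun_prop)).const_mul _]
  conv_rhs => rw [p.as_sum, map_sum, Finset.mul_sum]
  refine Finset.sum_congr rfl fun δ hδ => ?_
  have hd : ∑ j, δ j = d := by
    have := hp (mem_support_iff.1 hδ)
    simpa [Finsupp.weight_apply, Finsupp.sum_fintype] using this
  rw [integral_const_mul, integral_sphere_weight_sq_mul_prod_pow hα hμ δ hd,
    gaussFunctional_monomial]
  ring

end Dunkl

end

/-! ### Expansion of the kernel and integration over the cube. -/

noncomputable section

namespace Dunkl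

open MeasureTheory Set

lemma gamma_add_natCast {a : ℝ} (ha : 0 < a) (n : ℕ) :
    Real.Gamma (a + n) = (ascPochhammer ℝ n).eval a * Real.Gamma a := by
  induction n with
  | zero => simp
  | succ n ih =>
    rw [Nat.cast_succ, ← add_assoc, Real.Gamma_add_one (by positivity), ih,
      ascPochhammer_succ_eval]
    ring

lemma hasSum_one_sub_rpow_neg {a t : ℝ} (ha : 0 < a) (ht : |t| < 1) :
    HasSum (fun n : ℕ => Real.Gamma (a + n) / (Real.Gamma a * n.factorial) * t ^ n)
      ((1 - t) ^ (-a)) := by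
  have h := (Real.one_div_one_sub_rpow_hasFPowerSeriesOnBall_zero a).hasSum (y := t)
    (by simpa [← ofReal_norm, Real.norm_eq_abs] using ht)
  have h1 : 0 ≤ 1 - t := by linarith [le_abs_self t]
  simp only [FormalMultilinearSeries.ofScalars_apply_eq, zero_add, one_div, smul_eq_mul] at h
  rw [← Real.rpow_neg h1] at h
  refine h.congr_fun fun n => ?_
  have hG : 0 < Real.Gamma a := Real.Gamma_pos_of_pos ha
  have h2 := Ring.factorial_nsmul_multichoose_eq_ascPochhammer a n
  rw [Polynomial.ascPochhammer_smeval_eq_eval, nsmul_eq_mul] at h2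
  have hf : (0 : ℝ) < n.factorial := by positivity
  rw [Ring.choose, show a + n - 1 - n + 1 = a by ring, gamma_add_natCast ha, ← h2]
  congr 1
  field_simp

/-- The density of the full vector `τ`. -/
def cubeDensity {k : ℕ} (α : Fin (k + 1) → ℝ) (τ : ActiveIndex α → ℝ) : ℝ :=
  ∏ j : ActiveIndex α, tauDensity (α j) (τ j)

lemma active_pos {k : ℕ} {α : Fin (k + 1) → ℝ} (hα : ∀ j, 0 ≤ α j) (j : ActiveIndex α) :
    0 < α j := lt_of_le_of_ne (hα j) (Ne.symm j.2)

lemma volume_restrict_cube {k : ℕ} (α : Fin (k + 1) → ℝ) :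
    (volume : Measure (ActiveIndex α → ℝ)).restrict (cube α) =
      Measure.pi fun _ => (volume : Measure ℝ).restrict (Icc (-1) 1) := by
  rw [cube, volume_pi, Measure.restrict_pi_pi]

lemma isCompact_cube {k : ℕ} (α : Fin (k + 1) → ℝ) : IsCompact (cube α) :=
  isCompact_univ_pi fun _ => isCompact_Icc

lemma integrableOn_cubeDensity {k : ℕ} {α : Fin (k + 1) → ℝ} (hα : ∀ j, 0 ≤ α j) :
    IntegrableOn (cubeDensity α) (cube α) := by
  rw [IntegrableOn, volume_restrict_cube]
  refine Integrable.fintype_prod (f := fun (j : ActiveIndex α) t => tauDensity (α j) t) fun j => ?_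
  simpa [IntegrableOn] using integrableOn_mul_tauDensity (active_pos hα j)
    (f := fun _ => 1) continuous_const

lemma cubeDensity_nonneg {k : ℕ} {α : Fin (k + 1) → ℝ} (hα : ∀ j, 0 ≤ α j)
    {τ : ActiveIndex α → ℝ} (hτ : τ ∈ cube α) : 0 ≤ cubeDensity α τ :=
  Finset.prod_nonneg fun j _ => tauDensity_nonneg (active_pos hα j) (hτ j (mem_univ j))

lemma prod_eq_prod_active {k : ℕ} (α : Fin (k + 1) → ℝ) {f : Fin (k + 1) → ℝ}
    (hf : ∀ i, α i = 0 → f i = 1) : ∏ i, f i = ∏ j : ActiveIndex α, f j := by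
  rw [← Fintype.prod_subtype_mul_prod_subtype (fun i => α i ≠ 0) f]
  conv_rhs => rw [← mul_one (∏ j : ActiveIndex α, f j)]
  congr 1
  exact Finset.prod_eq_one fun i _ => hf i (not_not.1 i.2)

lemma dunklFactorial_zero_left (b : ℕ) : dunklFactorial 0 b = b.factorial := by
  induction b with
  | zero => simp [dunklFactorial]
  | succ b ih => rw [dunklFactorial, ih, Nat.factorial_succ]; simp [dunklInt]

lemma continuous_extendTau {k : ℕ} (α : Fin (k + 1) → ℝ) (i : Fin (k + 1)) :
    Continuous fun τ => extendTau α τ i := by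
  unfold extendTau
  split_ifs
  · fun_prop
  · fun_prop

lemma abs_extendTau_le {k : ℕ} {α : Fin (k + 1) → ℝ} {τ : ActiveIndex α → ℝ} (hτ : τ ∈ cube α)
    (i : Fin (k + 1)) : |extendTau α τ i| ≤ 1 := by
  unfold extendTau
  split_ifs with h
  · exact abs_le.2 (hτ ⟨i, h⟩ (mem_univ _))
  · simp

/-- Setting `τ_i = 1` when `α_i = 0` is consistent with the general formula, because the Dunkl
factorial is then the ordinary one and the quotient equals `1`. -/
lemma integral_cube_prod_pow {k : ℕ} {α : Fin (k + 1) → ℝ} (hα : ∀ j, 0 ≤ α j)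
    (β : Fin (k + 1) → ℕ) :
    ∫ τ in cube α, (∏ i, extendTau α τ i ^ β i) * cubeDensity α τ =
      ∏ i, ((β i).factorial / dunklFactorial (α i) (β i) : ℝ) := by
  have h1 : ∀ τ, (∏ i, extendTau α τ i ^ β i) * cubeDensity α τ =
      ∏ j : ActiveIndex α, (τ j ^ β j * tauDensity (α j) (τ j)) := fun τ => by
    rw [Finset.prod_mul_distrib, cubeDensity, prod_eq_prod_active α fun i hi => by
      simp [extendTau, hi]]
    congr 1
    exact Finset.prod_congr rfl fun j _ => by simp [extendTau, j.2]
  simp_rw [h1]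
  rw [volume_restrict_cube, integral_fintype_prod_eq_prod
    (fun (j : ActiveIndex α) (t : ℝ) => t ^ β j * tauDensity (α j) t),
    prod_eq_prod_active α fun i hi => by
      rw [hi, dunklFactorial_zero_left, div_self (by positivity)]]
  exact Finset.prod_congr rfl fun j _ => integral_pow_mul_tauDensity (active_pos hα j) _

/-- The bilinear form `τ₀ x₀ z₀ + ⋯ + τ_k x_k z_k`. -/
def tauInner {k : ℕ} (α : Fin (k + 1) → ℝ) (x z : Space k) (τ : ActiveIndex α → ℝ) : ℝ :=
  ∑ j, extendTau α τ j * x j * z j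

lemma continuous_tauInner {k : ℕ} (α : Fin (k + 1) → ℝ) (x z : Space k) :
    Continuous (tauInner α x z) :=
  continuous_finsetSum _ fun j _ => ((continuous_extendTau α j).mul_const _).mul_const _

lemma abs_tauInner_le {k : ℕ} {α : Fin (k + 1) → ℝ} (x z : Space k) {τ : ActiveIndex α → ℝ}
    (hτ : τ ∈ cube α) : |tauInner α x z τ| ≤ ‖x‖ * ‖z‖ := by
  calc |tauInner α x z τ| ≤ ∑ j, |extendTau α τ j * x j * z j| := Finset.abs_sum_le_sum_abs _ _
    _ ≤ ∑ j, |x j| * |z j| := Finset.sum_le_sum fun j _ => by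
        rw [abs_mul, abs_mul, mul_assoc]
        exact mul_le_of_le_one_left (by positivity) (abs_extendTau_le hτ j)
    _ ≤ √(∑ j, |x j| ^ 2) * √(∑ j, |z j| ^ 2) := Real.sum_mul_le_sqrt_mul_sqrt _ _ _
    _ = ‖x‖ * ‖z‖ := by simp [EuclideanSpace.norm_eq]

/-- The moments of `tauInner`: the images of the powers of the inner product under the intertwining
operator. -/
def innerMoment {k : ℕ} (α : Fin (k + 1) → ℝ) (n : ℕ) (x z : Space k) : ℝ :=
  ∫ τ in cube α, tauInner α x z τ ^ n * cubeDensity α τ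

/-- Multinomial expansion, in which the `β_i!` of the moments cancel those of the multinomial
coefficient. -/
lemma innerMoment_eq {k : ℕ} {α : Fin (k + 1) → ℝ} (hα : ∀ j, 0 ≤ α j) (n : ℕ) (x z : Space k) :
    innerMoment α n x z = ∑ β ∈ Finset.univ.piAntidiag n,
      n.factorial * ((∏ i, z i ^ β i) / ∏ i, dunklFactorial (α i) (β i)) * ∏ i, x i ^ β i := by
  have h1 : ∀ τ, tauInner α x z τ ^ n * cubeDensity α τ = ∑ β ∈ Finset.univ.piAntidiag n,
      (Nat.multinomial Finset.univ β * (∏ i, x i ^ β i) * ∏ i, z i ^ β i) *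
        ((∏ i, extendTau α τ i ^ β i) * cubeDensity α τ) := fun τ => by
    rw [tauInner, Finset.sum_pow_eq_sum_piAntidiag, Finset.sum_mul]
    refine Finset.sum_congr rfl fun β _ => ?_
    simp only [mul_pow, Finset.prod_mul_distrib]
    ring
  rw [innerMoment]
  simp_rw [h1]
  rw [integral_finsetSum]
  · refine Finset.sum_congr rfl fun β hβ => ?_
    rw [integral_const_mul, integral_cube_prod_pow hα, Finset.prod_div_distrib]
    have h2 := Nat.multinomial_spec Finset.univ β
    rw [(Finset.mem_piAntidiag.1 hβ).1] at h2
    rw [← h2]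
    push_cast
    ring
  · intro β _
    refine Integrable.const_mul ?_ _
    refine IntegrableOn.continuousOn_mul (Continuous.continuousOn ?_)
      (integrableOn_cubeDensity hα) (isCompact_cube α)
    exact continuous_finsetProd _ fun i _ => (continuous_extendTau α i).pow _

lemma abs_innerMoment_le {k : ℕ} {α : Fin (k + 1) → ℝ} (hα : ∀ j, 0 ≤ α j) (n : ℕ)
    (x z : Space k) :
    |innerMoment α n x z| ≤ (‖x‖ * ‖z‖) ^ n * ∫ τ in cube α, cubeDensity α τ := by
  rw [innerMoment, ← integral_const_mul, ← Real.norm_eq_abs]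
  refine norm_integral_le_of_norm_le ((integrableOn_cubeDensity hα).const_mul _) ?_
  refine (ae_restrict_iff' (isCompact_cube α).measurableSet).2 (Filter.Eventually.of_forall ?_)
  intro τ hτ
  rw [norm_mul, norm_pow, Real.norm_eq_abs, Real.norm_of_nonneg (cubeDensity_nonneg hα hτ)]
  have := cubeDensity_nonneg hα hτ
  have := abs_tauInner_le x z hτ
  gcongr

lemma continuous_innerMoment {k : ℕ} {α : Fin (k + 1) → ℝ} (hα : ∀ j, 0 ≤ α j) (n : ℕ)
    (z : Space k) : Continuous fun x => innerMoment α n x z := by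
  simp_rw [innerMoment_eq hα]
  fun_prop

lemma two_mul_div_one_add_sq_lt {r : ℝ} (hr : 1 < r) : 2 * r / (1 + r ^ 2) < 1 := by
  rw [div_lt_one (by positivity)]
  nlinarith [sq_pos_of_pos (sub_pos.2 hr)]

/-- The coefficients of the expansion of `(1 + r² - 2s) ^ (-a)` in powers of `s`. -/
def kernelCoeff (a r : ℝ) (n : ℕ) : ℝ :=
  (1 + r ^ 2) ^ (-a) * (Real.Gamma (a + n) / (Real.Gamma a * n.factorial)) *
    (2 / (1 + r ^ 2)) ^ n

lemma kernelCoeff_nonneg {a : ℝ} (ha : 0 < a) (r : ℝ) (n : ℕ) : 0 ≤ kernelCoeff a r n := by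
  have h1 : 0 < Real.Gamma (a + n) := Real.Gamma_pos_of_pos (by positivity)
  have h2 : 0 < Real.Gamma a := Real.Gamma_pos_of_pos ha
  unfold kernelCoeff
  positivity

/-- After factoring out `1 + r²` this is the binomial series at `2s / (1 + r²)`, whose modulus is at
most `2r / (1 + r²) < 1`. The case `s = r` provides the dominating series below. -/
lemma hasSum_kernelCoeff {a r s : ℝ} (ha : 0 < a) (hr : 1 < r) (hs : |s| ≤ r) :
    HasSum (fun n => kernelCoeff a r n * s ^ n) ((1 + r ^ 2 - 2 * s) ^ (-a)) := by
  have h0 : 0 < 1 + r ^ 2 := by positivity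
  have ht : |2 * s / (1 + r ^ 2)| < 1 := by
    rw [abs_div, abs_mul, abs_two, abs_of_pos h0]
    refine lt_of_le_of_lt ?_ (two_mul_div_one_add_sq_lt hr)
    gcongr
  have h := (hasSum_one_sub_rpow_neg ha ht).mul_left ((1 + r ^ 2) ^ (-a))
  rw [← Real.mul_rpow h0.le (by linarith [le_abs_self (2 * s / (1 + r ^ 2))]), mul_sub,
    mul_div_cancel₀ _ h0.ne', mul_one] at h
  refine h.congr_fun fun n => ?_
  rw [kernelCoeff, mul_div_right_comm, mul_pow]
  ring

lemma psi_eq {k : ℕ} {α : Fin (k + 1) → ℝ} {x : Space k} (hx : ‖x‖ = 1) (z : Space k)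
    (τ : ActiveIndex α → ℝ) :
    psi x z (extendTau α τ) = 1 + ‖z‖ ^ 2 - 2 * tauInner α x z τ := by
  rw [psi, hx, tauInner]; ring

lemma psi_pos {k : ℕ} {α : Fin (k + 1) → ℝ} {x z : Space k} (hx : ‖x‖ = 1) (hz : 1 < ‖z‖)
    {τ : ActiveIndex α → ℝ} (hτ : τ ∈ cube α) : 0 < psi x z (extendTau α τ) := by
  have h := abs_tauInner_le x z hτ
  rw [hx, one_mul] at h
  rw [psi_eq hx]
  nlinarith [le_abs_self (tauInner α x z τ), sq_pos_of_pos (sub_pos.2 hz)]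

lemma integrableOn_phiIntegrand {k : ℕ} {α : Fin (k + 1) → ℝ} (hα : ∀ j, 0 ≤ α j)
    {x z : Space k} (hx : ‖x‖ = 1) (hz : 1 < ‖z‖) :
    IntegrableOn (phiIntegrand α x z) (cube α) := by
  refine IntegrableOn.continuousOn_mul (g := fun τ => psi x z (extendTau α τ) ^ (-mu α))
    (g' := cubeDensity α) ?_ (integrableOn_cubeDensity hα) (isCompact_cube α)
  refine ContinuousOn.rpow_const ?_ fun τ hτ => Or.inl (psi_pos hx hz hτ).ne'
  simp_rw [psi_eq hx]
  have := continuous_tauInner α x z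
  fun_prop

lemma summable_kernelCoeff {a r : ℝ} (ha : 0 < a) (hr : 1 < r) :
    Summable fun n => kernelCoeff a r n * r ^ n :=
  (hasSum_kernelCoeff ha hr (abs_of_pos (by linarith)).le).summable

lemma hasSum_integral_phiIntegrand {k : ℕ} {α : Fin (k + 1) → ℝ} (hα : ∀ j, 0 ≤ α j)
    (hμ : 0 < mu α) {x z : Space k} (hx : ‖x‖ = 1) (hz : 1 < ‖z‖) :
    HasSum (fun n => kernelCoeff (mu α) ‖z‖ n * innerMoment α n x z)
      (∫ τ in cube α, phiIntegrand α x z τ) := by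
  simp_rw [innerMoment, ← integral_const_mul]
  have hs := summable_kernelCoeff hμ hz
  have hcube := (isCompact_cube α).measurableSet
  refine hasSum_integral_of_dominated_convergence
    (fun n τ => kernelCoeff (mu α) ‖z‖ n * ‖z‖ ^ n * cubeDensity α τ) (fun n => ?_) (fun n => ?_)
    (Filter.Eventually.of_forall fun τ => hs.mul_right _) ?_ ?_
  · exact ((continuous_tauInner α x z).pow n).aestronglyMeasurable.mul
      (integrableOn_cubeDensity hα).aestronglyMeasurable |>.const_mul _
  · refine (ae_restrict_iff' hcube).2 (Filter.Eventually.of_forall fun τ hτ => ?_)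
    have h1 := cubeDensity_nonneg hα hτ
    have h2 := abs_tauInner_le x z hτ
    have h3 := kernelCoeff_nonneg hμ ‖z‖ n
    rw [hx, one_mul] at h2
    rw [norm_mul, norm_mul, norm_pow, Real.norm_eq_abs (tauInner α x z τ),
      Real.norm_of_nonneg h1, Real.norm_of_nonneg h3, mul_assoc]
    gcongr
  · simp_rw [tsum_mul_right]
    exact (integrableOn_cubeDensity hα).const_mul _
  · refine (ae_restrict_iff' hcube).2 (Filter.Eventually.of_forall fun τ hτ => ?_)
    have h2 := abs_tauInner_le x z hτ
    rw [hx, one_mul] at h2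
    have h := (hasSum_kernelCoeff hμ hz h2).mul_right (cubeDensity α τ)
    rw [← psi_eq hx] at h
    exact h.congr_fun fun n => by ring

end Dunkl

end

/-! ### Integration over the sphere and summation of the series. -/

noncomputable section

namespace Dunkl

open MeasureTheory Set MvPolynomial

lemma sum_piAntidiag_coeff {σ : Type*} [Fintype σ] [DecidableEq σ] {p : MvPolynomial σ ℝ} {m : ℕ}
    (hp : p.IsHomogeneous m) (n : ℕ) (z : σ → ℝ) :
    ∑ β ∈ Finset.univ.piAntidiag n, coeff (Finsupp.equivFunOnFinite.symm β) p * ∏ i, z i ^ β i =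
      if n = m then eval z p else 0 := by
  have hdeg : ∀ d : σ →₀ ℕ, coeff d p ≠ 0 → ∑ i, d i = m := fun d hd => by
    simpa [Finsupp.weight_apply, Finsupp.sum_fintype] using hp hd
  split_ifs with h
  · subst h
    rw [eval_eq']
    symm
    refine Finset.sum_of_injOn (fun d : σ →₀ ℕ => (d : σ → ℕ)) DFunLike.coe_injective.injOn
      (fun d hd => ?_) (fun β _ hβ => ?_) fun d _ => ?_
    · simpa [Finset.mem_piAntidiag] using hdeg d (mem_support_iff.1 hd)
    · have : coeff (Finsupp.equivFunOnFinite.symm β) p = 0 := by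
        by_contra h0
        exact hβ ⟨_, mem_support_iff.2 h0, rfl⟩
      rw [this, zero_mul]
    · have : Finsupp.equivFunOnFinite.symm (d : σ → ℕ) = d := Finsupp.ext fun _ => rfl
      simp only [this]
  · refine Finset.sum_eq_zero fun β hβ => ?_
    have h1 : ∑ i, β i = n := (Finset.mem_piAntidiag.1 hβ).1
    have : coeff (Finsupp.equivFunOnFinite.symm β) p = 0 := by
      by_contra h0
      exact h (h1.symm.trans (hdeg _ h0))
    rw [this, zero_mul]

lemma isHomogeneous_normSqPoly (σ : Type*) [Fintype σ] : (normSqPoly σ).IsHomogeneous 2 :=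
  IsHomogeneous.sum _ _ _ fun i _ => isHomogeneous_X_pow i 2

lemma eval_normSqPoly {k : ℕ} (z : Space k) :
    eval (fun i => z i) (normSqPoly (Fin (k + 1))) = ‖z‖ ^ 2 := by
  simp [normSqPoly, EuclideanSpace.real_norm_sq_eq]

/-- The value at `z` of the homogeneous component of degree `n` of `exp (‖x‖² / 2) p`, where `p` is
homogeneous of degree `m`. -/
def expMulComponent {k : ℕ} (m n : ℕ) (p : MvPolynomial (Fin (k + 1)) ℝ) (z : Space k) : ℝ :=
  ∑ i ∈ Finset.range (n + 1),
    if n = 2 * i + m then 1 / (2 ^ i * i.factorial) * (‖z‖ ^ (2 * i) * eval (fun i => z i) p) else 0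

lemma sum_piAntidiag_coeff_expMul {k : ℕ} {p : MvPolynomial (Fin (k + 1)) ℝ} {m : ℕ}
    (hp : p.IsHomogeneous m) (n : ℕ) (z : Space k) :
    ∑ β ∈ Finset.univ.piAntidiag n,
        coeff (Finsupp.equivFunOnFinite.symm β) (expMul (n + 1) p) * ∏ i, z i ^ β i =
      expMulComponent m n p z := by
  simp only [expMul, coeff_sum, coeff_smul, Finset.sum_mul, expMulComponent]
  rw [Finset.sum_comm]
  refine Finset.sum_congr rfl fun i _ => ?_
  have hi : (normSqPoly (Fin (k + 1)) ^ i * p).IsHomogeneous (2 * i + m) :=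
    ((isHomogeneous_normSqPoly _).pow i).mul hp
  simp only [smul_eq_mul, mul_assoc]
  rw [← Finset.mul_sum, sum_piAntidiag_coeff hi n]
  split_ifs
  · rw [map_mul, map_pow, eval_normSqPoly, ← pow_mul]
  · rw [mul_zero]

lemma expMulComponent_add_two_mul {k : ℕ} (m j : ℕ) (p : MvPolynomial (Fin (k + 1)) ℝ)
    (z : Space k) :
    expMulComponent m (m + 2 * j) p z =
      1 / (2 ^ j * j.factorial) * (‖z‖ ^ (2 * j) * eval (fun i => z i) p) := by
  rw [expMulComponent, Finset.sum_eq_single j]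
  · rw [if_pos (by ring)]
  · intro i _ hi
    rw [if_neg (by omega)]
  · intro h
    simp at h
    omega

lemma expMulComponent_eq_zero {k : ℕ} {m n : ℕ} (h : n ∉ range fun j => m + 2 * j)
    (p : MvPolynomial (Fin (k + 1)) ℝ) (z : Space k) : expMulComponent m n p z = 0 :=
  Finset.sum_eq_zero fun i _ => if_neg fun hi => h ⟨i, by simp only; omega⟩

/-- The reproducing property of the powers of the inner product for `h`-harmonic polynomials. -/
lemma integral_sphere_innerMoment_mul {k : ℕ} {α : Fin (k + 1) → ℝ} (hα : ∀ j, 0 ≤ α j)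
    (hμ : 0 < mu α) {m : ℕ} {p : MvPolynomial (Fin (k + 1)) ℝ} (hp : p.IsHomogeneous m)
    (hh : ∑ j, polyDunkl α j (polyDunkl α j p) = 0) (n : ℕ) (z : Space k) :
    ∫ x : Metric.sphere (0 : Space k) 1,
        weight α x ^ 2 * (innerMoment α n x z * eval (fun i => (x : Space k) i) p)
        ∂surfaceMeasure k =
      n.factorial * (2 / (2 ^ (((n + m : ℕ) : ℝ) / 2) *
        Real.Gamma (mu α + 1 + (n + m : ℕ) / 2)) * gaussFunctional α 1) *
          expMulComponent m n p z := by
  have h1 : ∀ x : Metric.sphere (0 : Space k) 1,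
      weight α x ^ 2 * (innerMoment α n x z * eval (fun i => (x : Space k) i) p) =
        ∑ β ∈ Finset.univ.piAntidiag n,
          n.factorial * ((∏ i, z i ^ β i) / ∏ i, dunklFactorial (α i) (β i)) *
            (weight α x ^ 2 * eval (fun i => (x : Space k) i)
              (monomial (Finsupp.equivFunOnFinite.symm β) 1 * p)) := fun x => by
    rw [innerMoment_eq hα, Finset.sum_mul, Finset.mul_sum]
    refine Finset.sum_congr rfl fun β _ => ?_
    rw [map_mul, eval_monomial, Finsupp.prod_fintype _ _ fun _ => pow_zero _]
    simp only [Finsupp.equivFunOnFinite_symm_apply_apply]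
    ring
  simp_rw [h1]
  have hw := continuous_weight hα
  rw [integral_finsetSum]
  · rw [← sum_piAntidiag_coeff_expMul hp, Finset.mul_sum]
    refine Finset.sum_congr rfl fun β hβ => ?_
    have hd : (Finsupp.equivFunOnFinite.symm β).degree = n := by
      simpa [Finsupp.degree_eq_sum] using (Finset.mem_piAntidiag.1 hβ).1
    have hhom : (monomial (Finsupp.equivFunOnFinite.symm β) 1 * p).IsHomogeneous (n + m) :=
      (isHomogeneous_monomial 1 hd).mul hp
    have hγ : ∏ i, dunklFactorial (α i) (β i) ≠ 0 :=
      Finset.prod_ne_zero_iff.2 fun i _ => (dunklFactorial_pos (hα i) _).ne'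
    -- The truncation `N = n + 1` is long enough for every coefficient of degree `n`.
    rw [integral_const_mul, integral_sphere_weight_sq_mul_eval hα hμ hhom,
      gaussFunctional_monomial_mul hp hh (N := n + 1) (by omega)]
    simp only [Finsupp.equivFunOnFinite_symm_apply_apply]
    field_simp
  · intro β _
    refine (integrable_surfaceMeasure ?_).const_mul _
    exact ((hw.comp continuous_subtype_val).pow 2).mul
      ((continuous_eval_space _).comp continuous_subtype_val)

/-- The generalized binomial series at `s = r⁻²`, which lies in `(0, 1)` precisely because `z` is
outside the closed unit ball. -/
lemma hasSum_ballotCoeff_mul {a r : ℝ} (ha : 0 < a) (hr : 1 < r) :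
    HasSum (fun j : ℕ => ballotCoeff a j * (r ^ (2 * j) * (1 + r ^ 2) ^ (-a - 2 * j)))
      (r ^ (-2 * a)) := by
  have hr0 : 0 < r := by linarith
  have h := (hasSum_ballotCoeff ha (s := (r ^ 2)⁻¹) (by positivity)
    (inv_lt_one_of_one_lt₀ (one_lt_pow₀ hr two_ne_zero))).mul_left (r ^ (-2 * a))
  rw [mul_one] at h
  refine h.congr_fun fun j => ?_
  have e1 : 1 + (r ^ 2)⁻¹ = (1 + r ^ 2) * (r ^ 2)⁻¹ := by field_simp; ring
  have e2 : ((r ^ 2)⁻¹ : ℝ) ^ (-a - 2 * j) = r ^ (2 * a) * r ^ (4 * j) := by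
    rw [Real.inv_rpow (by positivity), ← Real.rpow_neg (by positivity), ← Real.rpow_natCast,
      ← Real.rpow_mul hr0.le, ← Real.rpow_natCast r (4 * j), ← Real.rpow_add hr0]
    congr 1; push_cast; ring
  have e3 : r ^ (-2 * a) = (r ^ (2 * a))⁻¹ := by
    rw [← Real.rpow_neg hr0.le]; congr 1; ring
  have h3 : 0 < r ^ (2 * a) := by positivity
  rw [e1, Real.mul_rpow (by positivity) (by positivity), e2, e3, inv_pow, ← pow_mul,
    show 4 * j = 2 * j + 2 * j by ring, pow_add]
  field_simp

/-- Termwise integration of the expansion of the kernel `Φ` over the sphere. -/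
lemma hasSum_integral_sphere {k : ℕ} {α : Fin (k + 1) → ℝ} (hα : ∀ j, 0 ≤ α j) (hμ : 0 < mu α)
    {f : Space k → ℝ} (hf : Continuous f) {z : Space k} (hz : 1 < ‖z‖) :
    Integrable (fun x : Metric.sphere (0 : Space k) 1 =>
        weight α x ^ 2 * ((∫ τ in cube α, phiIntegrand α x z τ) * f x)) (surfaceMeasure k) ∧
      HasSum (fun n => kernelCoeff (mu α) ‖z‖ n * ∫ x : Metric.sphere (0 : Space k) 1,
          weight α x ^ 2 * (innerMoment α n x z * f x) ∂surfaceMeasure k)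
        (∫ x : Metric.sphere (0 : Space k) 1,
          weight α x ^ 2 * ((∫ τ in cube α, phiIntegrand α x z τ) * f x) ∂surfaceMeasure k) := by
  have hw := continuous_weight hα
  have hg : Continuous fun x : Metric.sphere (0 : Space k) 1 => weight α x ^ 2 * f x :=
    ((hw.comp continuous_subtype_val).pow 2).mul (hf.comp continuous_subtype_val)
  obtain ⟨M, hM⟩ := isCompact_univ.exists_bound_of_continuousOn hg.continuousOn
  set D := ∫ τ in cube α, cubeDensity α τ
  have hs := summable_kernelCoeff hμ hz
  have hs' := hs.mul_right (D * M)
  have hpt : ∀ x : Metric.sphere (0 : Space k) 1,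
      HasSum (fun n => kernelCoeff (mu α) ‖z‖ n *
        (weight α x ^ 2 * (innerMoment α n x z * f x)))
        (weight α x ^ 2 * ((∫ τ in cube α, phiIntegrand α x z τ) * f x)) := fun x => by
    have h := (hasSum_integral_phiIntegrand hα hμ (x := x) (by simp) hz).mul_left
      (weight α x ^ 2 * f x)
    rw [show weight α (x : Space k) ^ 2 * ((∫ τ in cube α, phiIntegrand α x z τ) * f x) =
      weight α x ^ 2 * f x * ∫ τ in cube α, phiIntegrand α x z τ by ring]
    exact h.congr_fun fun n => by ring
  have hcont : ∀ n, Continuous fun x : Metric.sphere (0 : Space k) 1 =>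
      kernelCoeff (mu α) ‖z‖ n * (weight α x ^ 2 * (innerMoment α n x z * f x)) := fun n => by
    have := continuous_innerMoment hα n z
    fun_prop
  have hbound : ∀ n (x : Metric.sphere (0 : Space k) 1),
      ‖kernelCoeff (mu α) ‖z‖ n * (weight α x ^ 2 * (innerMoment α n x z * f x))‖ ≤
        kernelCoeff (mu α) ‖z‖ n * ‖z‖ ^ n * (D * M) := fun n x => by
    have h1 := abs_innerMoment_le hα n x z
    rw [show ‖(x : Space k)‖ = 1 by simp, one_mul] at h1
    have h2 := hM x (mem_univ _)
    have h3 := kernelCoeff_nonneg hμ ‖z‖ n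
    rw [show weight α (x : Space k) ^ 2 * (innerMoment α n x z * f x) =
      innerMoment α n x z * (weight α x ^ 2 * f x) by ring, norm_mul, norm_mul,
      Real.norm_of_nonneg h3, Real.norm_eq_abs (innerMoment _ _ _ _)]
    calc _ ≤ kernelCoeff (mu α) ‖z‖ n * (‖z‖ ^ n * D * M) := by
          gcongr
          exact (abs_nonneg _).trans h1
      _ = _ := by ring
  -- Integrability follows from continuity on the compact sphere: the integrand is a series of
  -- continuous functions to which the Weierstrass M-test applies.
  refine ⟨integrable_surfaceMeasure ?_, ?_⟩
  · convert continuous_tsum hcont hs' hbound with x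
    exact (hpt x).tsum_eq.symm
  · simp_rw [← integral_const_mul]
    have : IsFiniteMeasure (surfaceMeasure k) := by unfold surfaceMeasure; infer_instance
    exact hasSum_integral_of_dominated_convergence _
      (fun n => (hcont n).aestronglyMeasurable)
      (fun n => Filter.Eventually.of_forall (hbound n))
      (Filter.Eventually.of_forall fun _ => hs') (integrable_const _)
      (Filter.Eventually.of_forall hpt)

/-- The expansion coefficients of the sphere integral are those of the generalized binomial
series. -/
lemma kernelCoeff_mul_eq_ballotCoeff {μ : ℝ} (hμ : 0 < μ) (r G y : ℝ) (hG : 0 < G) (m j : ℕ) :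
    2 * (μ + m) * (Real.Gamma μ / (4 * G)) * (kernelCoeff μ r (m + 2 * j) *
      ((m + 2 * j).factorial * (2 / (2 ^ (((m + 2 * j + m : ℕ) : ℝ) / 2) *
        Real.Gamma (μ + 1 + (m + 2 * j + m : ℕ) / 2)) * G) *
          (1 / (2 ^ j * j.factorial) * (r ^ (2 * j) * y)))) =
      ballotCoeff (μ + m) j * (r ^ (2 * j) * (1 + r ^ 2) ^ (-(μ + m) - 2 * j)) * y := by
  have e1 : (((m + 2 * j + m : ℕ) : ℝ) / 2) = (m + j : ℕ) := by push_cast; ring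
  have e2 : (1 + r ^ 2) ^ (-(μ + m) - 2 * j) =
      (1 + r ^ 2) ^ (-μ) * ((1 + r ^ 2) ^ (m + 2 * j))⁻¹ := by
    rw [← Real.rpow_natCast _ (m + 2 * j), ← Real.rpow_neg (by positivity),
      ← Real.rpow_add (by positivity)]
    congr 1; push_cast; ring
  rw [e1, Real.rpow_natCast, e2, kernelCoeff, ballotCoeff]
  rw [show μ + 1 + ((m + j : ℕ) : ℝ) = μ + m + j + 1 by push_cast; ring,
    show μ + ((m + 2 * j : ℕ) : ℝ) = μ + m + 2 * j by push_cast; ring, div_pow]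
  have h1 : 0 < Real.Gamma μ := Real.Gamma_pos_of_pos hμ
  have h2 : 0 < Real.Gamma (μ + m + j + 1) := Real.Gamma_pos_of_pos (by positivity)
  generalize Real.Gamma (μ + m + j + 1) = g at h2
  generalize Real.Gamma (μ + m + 2 * j) = g'
  have h3 : (0 : ℝ) < (m + 2 * j).factorial := by positivity
  have h4 : (0 : ℝ) < j.factorial := by positivity
  have h5 : 0 < (1 + r ^ 2) ^ (m + 2 * j) := by positivity
  generalize (1 + r ^ 2) ^ (m + 2 * j) = R at h5
  -- The powers of two from the kernel cancel those from the sphere integral and from the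
  -- exponential series.
  have e3 : (2 : ℝ) ^ (m + 2 * j) = 2 ^ (m + j) * 2 ^ j := by rw [← pow_add]; congr 1; ring
  rw [e3]
  field_simp
  norm_num

end Dunkl

end

theorem theorem3p1 {k : ℕ} (α : Fin (k + 1) → ℝ) (hα : ∀ j, 0 ≤ α j) (hμ : 0 < Dunkl.mu α)
    (m : ℕ) (Y : Dunkl.Space k → ℝ) (hY : Dunkl.IsSphericalHHarmonic α m Y)
    (z : Dunkl.Space k) (hz : 1 < ‖z‖) :
    (∀ x : Metric.sphere (0 : Dunkl.Space k) 1,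
      MeasureTheory.IntegrableOn (Dunkl.phiIntegrand α x z) (Dunkl.cube α)) ∧
    MeasureTheory.Integrable
      (fun x : Metric.sphere (0 : Dunkl.Space k) 1 =>
        Dunkl.weight α x ^ 2 * Dunkl.phi α x z * Y x) (Dunkl.surfaceMeasure k) ∧
    Dunkl.external α m Y z =
      2 * (Dunkl.mu α + (m : ℝ)) *
        ∫ x : Metric.sphere (0 : Dunkl.Space k) 1,
          Dunkl.weight α x ^ 2 * Dunkl.phi α x z * Y x ∂(Dunkl.surfaceMeasure k) := by
  obtain ⟨p, hp, hh, rfl⟩ := hY.exists_polyDunkl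
  refine ⟨fun x => Dunkl.integrableOn_phiIntegrand hα (by simp) hz, ?_⟩
  obtain ⟨hint, hsum⟩ := Dunkl.hasSum_integral_sphere hα hμ (Dunkl.continuous_eval_space p) hz
  have hΦ : ∀ x : Metric.sphere (0 : Dunkl.Space k) 1,
      Dunkl.weight α x ^ 2 * Dunkl.phi α x z * MvPolynomial.eval (fun i => (x : Dunkl.Space k) i) p
        = Real.Gamma (Dunkl.mu α) / (4 * ∏ j, Real.Gamma (α j + 1 / 2)) *
          (Dunkl.weight α x ^ 2 * ((∫ τ in Dunkl.cube α, Dunkl.phiIntegrand α x z τ) *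
            MvPolynomial.eval (fun i => (x : Dunkl.Space k) i) p)) := fun x => by
    rw [Dunkl.phi]; ring
  simp_rw [hΦ]
  refine ⟨hint.const_mul _, ?_⟩
  rw [MeasureTheory.integral_const_mul, ← mul_assoc]
  have ha : 0 < Dunkl.mu α + m := by positivity
  have hG : 0 < ∏ j, Real.Gamma (α j + 1 / 2) :=
    Finset.prod_pos fun j _ => Real.Gamma_pos_of_pos (by have := hα j; positivity)
  have h1 := hsum.mul_left (2 * (Dunkl.mu α + (m : ℝ)) *
    (Real.Gamma (Dunkl.mu α) / (4 * ∏ j, Real.Gamma (α j + 1 / 2))))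
  simp_rw [Dunkl.integral_sphere_innerMoment_mul hα hμ hp hh, Dunkl.gaussFunctional_one] at h1
  have hinj : Function.Injective fun j : ℕ => m + 2 * j := fun i j h => by
    simp only at h; omega
  -- The series over `n` is reindexed by `n = m + 2j`, since all other terms vanish; uniqueness of
  -- sums then identifies it with the generalized binomial series times `Y(z)`.
  rw [← hinj.hasSum_iff fun n hn => by rw [Dunkl.expMulComponent_eq_zero hn]; ring] at h1
  have h2 := (Dunkl.hasSum_ballotCoeff_mul ha hz).mul_right
    (MvPolynomial.eval (fun i => z i) p)
  have h3 := h1.unique (h2.congr_fun fun j => by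
    simp only [Function.comp_apply]
    rw [Dunkl.expMulComponent_add_two_mul]
    exact Dunkl.kernelCoeff_mul_eq_ballotCoeff hμ ‖z‖ _ _ hG m j)
  rw [h3, Dunkl.external]
  congr 2
  ring
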